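/- Let $\Omega\subset\mathbb C^n$ be a bounded domain and let $\mu$ be a non-negative Borel measure in $\Omega$. For an open set $D\subset\Omega$ and a non-negative Borel measure $\nu$ in $D$, a solution of the Dirichlet problem $\mathcal M(D,\nu)$ is a plurisubharmonic function $u$ in $D$ that is Hölder continuous on $\overline D$ and satisfies $(dd^c u)^n=\nu$ in $D$ and $u=0$ on $\partial D$, where $(dd^c u)^n$ is the complex Monge–Ampère measure of $u$. A function is called a sub-solution of $\mathcal M(D,\mu)$ if it is a solution of $\mathcal M(D,\nu)$ for some measure $\nu\ge\mu$ in $D$; it is called negative if it is $<0$ in $D$. Suppose that for every $z\in\overline\Omega$ there is a radius $r_z>0$ such that $\mathcal M(\Omega\cap\mathbb B(z,r_z),\mu)$ has a negative sub-solution, where $\mathbb B(z,r_z)$ is the open Euclidean ball. Then there is a Hölder continuous function $u$ on $\overline\Omega$ that is plurisubharmonic in $\Omega$ and satisfies $$(dd^c u)^n\ge\mu\quad\text{on }\Omega .$$ -/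

import Mathlib

open MeasureTheory Filter Topology Set
open scoped NNReal ContDiff

noncomputable section

/-- The space `ℂⁿ` with its Hermitian norm and its Borel `σ`-algebra. -/
abbrev Cn (n : ℕ) : Type := EuclideanSpace ℂ (Fin n)

/-- The `j`-th vector of the standard basis of `ℂⁿ`. -/
def stdVec {n : ℕ} (j : Fin n) : Cn n := EuclideanSpace.single j (1 : ℂ)

/-- The Wirtinger derivative `∂f/∂z_j = (∂f/∂x_j - i ∂f/∂y_j) / 2`. -/
def wirtinger {n : ℕ} (j : Fin n) (f : Cn n → ℂ) (p : Cn n) : ℂ :=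
  (1 / 2 : ℂ) *
    (fderiv ℝ f p (stdVec j) - Complex.I * fderiv ℝ f p (Complex.I • stdVec j))

/-- The conjugate Wirtinger derivative `∂f/∂z̄_j = (∂f/∂x_j + i ∂f/∂y_j) / 2`. -/
def wirtingerBar {n : ℕ} (j : Fin n) (f : Cn n → ℂ) (p : Cn n) : ℂ :=
  (1 / 2 : ℂ) *
    (fderiv ℝ f p (stdVec j) + Complex.I * fderiv ℝ f p (Complex.I • stdVec j))

/-- The complex Hessian `(∂²u/∂z_j∂z̄_k)` of a real function. -/
def complexHessian {n : ℕ} (u : Cn n → ℝ) (p : Cn n) : Matrix (Fin n) (Fin n) ℂ :=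
  Matrix.of fun j k => wirtinger j (wirtingerBar k fun w => (u w : ℂ)) p

/-- For a function `u` of class `C²`, with `d = ∂ + ∂̄` and `d^c = i(∂̄ - ∂)`, the form `(dd^c u)ⁿ` is
`4ⁿ n! det(∂²u/∂z_j∂z̄_k)` times the Lebesgue volume form; this is the coefficient.
(The determinant is real, since the Hessian is Hermitian.) -/
def mongeAmpereDensity {n : ℕ} (u : Cn n → ℝ) (p : Cn n) : ℝ :=
  (4 : ℝ) ^ n * (n.factorial : ℝ) * (complexHessian u p).det.re

/-- A finite-valued function is plurisubharmonic in the open set `D`: it is upper semicontinuous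
and satisfies the sub-mean value inequality on every closed disc `{a + ζ b : |ζ| ≤ 1}` contained
in `D`. (A finite value at the centre forces the mean value to be finite, so integrability on the
circle is part of the inequality.) -/
structure IsPSH {n : ℕ} (D : Set (Cn n)) (u : Cn n → ℝ) : Prop where
  usc : UpperSemicontinuousOn u D
  subMean : ∀ a b : Cn n, (∀ ζ : ℂ, ‖ζ‖ ≤ 1 → a + ζ • b ∈ D) →
    CircleIntegrable (fun ζ : ℂ => u (a + ζ • b)) 0 1 ∧
      u a ≤ Real.circleAverage (fun ζ : ℂ => u (a + ζ • b)) 0 1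

/-- `u` is Hölder continuous on `S`, with some exponent in `(0, 1]`. -/
def IsHolderOn {n : ℕ} (S : Set (Cn n)) (u : Cn n → ℝ) : Prop :=
  ∃ C α : ℝ≥0, 0 < α ∧ α ≤ 1 ∧ HolderOnWith C α u S

/-- `(dd^c u)ⁿ = ν` in the open set `D`, for a plurisubharmonic function `u` in `D`: the measure
`ν` is finite on the compact subsets of `D`, and for every open `U ⊆ D` and every sequence of
smooth plurisubharmonic functions `v_i` in `U` that decreases to `u` in `U`, the measures
`(dd^c v_i)ⁿ` converge to `ν` weakly in `U`. (On relatively compact open subsets of `D`, standard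
mollifications of `u` are such sequences, so `ν` is unique in `D`.) Only the restriction of `ν`
to `D` matters. -/
structure IsMongeAmpere {n : ℕ} (D : Set (Cn n)) (u : Cn n → ℝ) (ν : Measure (Cn n)) :
    Prop where
  finite_on_compacts : ∀ K : Set (Cn n), IsCompact K → K ⊆ D → ν K < ⊤
  weak_limit : ∀ U : Set (Cn n), IsOpen U → U ⊆ D → ∀ v : ℕ → Cn n → ℝ,
    (∀ i, IsPSH U (v i)) → (∀ i, ContDiffOn ℝ ∞ (v i) U) →
    (∀ z ∈ U, Antitone fun i => v i z) →
    (∀ z ∈ U, Tendsto (fun i => v i z) atTop (𝓝 (u z))) →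
    ∀ f : Cn n → ℝ, Continuous f → HasCompactSupport f → tsupport f ⊆ U →
      Tendsto (fun i => ∫ z, f z * mongeAmpereDensity (v i) z) atTop (𝓝 (∫ z, f z ∂ν))

/-- `u` is a solution of the Dirichlet problem `M(D, ν)`: it is plurisubharmonic in `D`, Hölder
continuous on the closure of `D`, with `(dd^c u)ⁿ = ν` in `D` and `u = 0` on the boundary. -/
structure IsSolution {n : ℕ} (D : Set (Cn n)) (ν : Measure (Cn n)) (u : Cn n → ℝ) :
    Prop where
  psh : IsPSH D u
  holder : IsHolderOn (closure D) u
  mongeAmpere : IsMongeAmpere D u ν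
  boundary : ∀ z ∈ frontier D, u z = 0

/-- `u` is a sub-solution of `M(D, μ)`: a solution of `M(D, ν)` for some measure `ν ≥ μ` on `D`. -/
def IsSubsolution {n : ℕ} (D : Set (Cn n)) (μ : Measure (Cn n)) (u : Cn n → ℝ) : Prop :=
  ∃ ν : Measure (Cn n), μ.restrict D ≤ ν.restrict D ∧ IsSolution D ν u

/-- `(dd^c u)ⁿ ≥ μ` on `D`: the Monge-Ampère measure of `u` in `D` exists and dominates `μ`. -/
def MongeAmpereGE {n : ℕ} (D : Set (Cn n)) (u : Cn n → ℝ) (μ : Measure (Cn n)) : Prop :=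
  ∃ ν : Measure (Cn n), IsMongeAmpere D u ν ∧ μ.restrict D ≤ ν.restrict D

end

/-! The heart is a gluing argument. Let `w` be a negative sub-solution on `Ω ∩ B(z, r)` with `|w| ≤
M`, and let `q(x) = A(‖x - z‖² - (2r/3)²)` with `A = 3M/r²`. Negativity in the piece and vanishing
on its boundary give `w ≤ 0` on its closure, so `w < q` where `‖x - z‖ > 2r/3`; where `‖x - z‖ <
r/3`, `q ≤ -M ≤ w`. Hence `max(w, q)`, continued by `q`, is plurisubharmonic in `Ω`, Hölder on the
closure, and equal to `w` near `z` (`IsSolution.exists_extension`). Finitely many of the balls `B(z,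
r/3)` cover the compact closure of `Ω`; `u` is the sum of the corresponding extensions. Near each
point `u` is one of the `w` plus a plurisubharmonic function, and `det(A + B) ≥ det A` for positive
semidefinite matrices, so its Monge-Ampère measure dominates that of `w`, hence `μ`
(`IsMongeAmpere.integral_le_of_add`). Inequality of measures is local
(`restrict_le_of_forall_mem_nhds`).

Since `u` is not smooth, its Monge-Ampère measure must first be shown to exist: all decreasing
smooth plurisubharmonic approximations must have the same weak limit. This follows from stability
under uniform convergence (`exists_forall_abs_integral_sub_le`). Along the segment between two
smooth plurisubharmonic functions the derivative of `∫ f det` pairs the adjugate of the Hessian with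
the Hessian of the difference. The adjugate is divergence free (Piola), so two integrations by parts
move the Hessian to `f`; what remains is the sup norm of the difference times the integral of the
trace of the adjugate, bounded by the Chern-Levine-Nirenberg inequality. Mollifications therefore
have Cauchy masses, Dini's theorem makes every decreasing approximation locally uniform, and the
Riesz theorem turns the limit functional into a measure. -/

/-! ### Derivations, determinants and Piola's identity -/

section Piola

variable {S R : Type*} [CommRing S] [CommRing R] [Algebra S R]
  {ι : Type*} [Fintype ι] [DecidableEq ι]

omit [Fintype ι] in
/-- The Leibniz rule for a product over a finite set. -/
theorem Derivation.leibniz_prod_update (D : Derivation S R R) (s : Finset ι) (a : ι → R) :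
    D (∏ i ∈ s, a i) = ∑ i ∈ s, ∏ j ∈ s, Function.update a i (D (a i)) j := by
  induction s using Finset.induction_on with
  | empty => simp
  | insert i s hi ih =>
    rw [Finset.prod_insert hi, D.leibniz, ih, Finset.sum_insert hi, Finset.prod_insert hi]
    have h1 : ∏ j ∈ s, Function.update a i (D (a i)) j = ∏ j ∈ s, a j :=
      Finset.prod_congr rfl fun j hj => by
        rw [Function.update_of_ne]; rintro rfl; exact hi hj
    have h2 : ∑ k ∈ s, ∏ j ∈ insert i s, Function.update a k (D (a k)) j =
        ∑ k ∈ s, a i * ∏ j ∈ s, Function.update a k (D (a k)) j :=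
      Finset.sum_congr rfl fun k hk => by
        rw [Finset.prod_insert hi, Function.update_of_ne]; rintro rfl; exact hi hk
    rw [h1, h2, ← Finset.mul_sum]
    simp only [Function.update_self, smul_eq_mul]
    ring

/-- A derivation acts on a determinant column by column. -/
theorem Derivation.map_det (D : Derivation S R R) (M : Matrix ι ι R) :
    D M.det = ∑ j, (M.updateCol j fun i => D (M i j)).det := by
  simp only [Matrix.det_apply, map_sum]
  rw [Finset.sum_comm]
  refine Finset.sum_congr rfl fun σ _ => ?_
  rw [← Finset.smul_sum]
  have : D (∏ i, M (σ i) i) =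
      ∑ j, ∏ i, (M.updateCol j fun i => D (M i j)) (σ i) i := by
    rw [D.leibniz_prod_update]
    refine Finset.sum_congr rfl fun j _ => Finset.prod_congr rfl fun i _ => ?_
    by_cases h : i = j
    · subst h; simp
    · simp [h]
  rw [← this, Units.smul_def, Units.smul_def]
  exact map_zsmul D _ _


theorem Matrix.adjugate_eq_det_updateCol (A : Matrix ι ι R) (i j : ι) :
    A.adjugate i j = (A.updateCol i (Pi.single j 1)).det := by
  rw [← Matrix.cramer_apply, Matrix.cramer_eq_adjugate_mulVec, Matrix.mulVec_single_one]
  rfl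

/-- Piola's identity: the rows of the adjugate of a Jacobian matrix are divergence free. -/
theorem Derivation.sum_map_adjugate_eq_zero (h2 : ∀ x : R, x + x = 0 → x = 0)
    (D : ι → Derivation S R R)
    (hD : ∀ i j f, D i (D j f) = D j (D i f)) (g : ι → R) (l : ι) :
    ∑ j, D j ((Matrix.of fun l j => D j (g l)).adjugate j l) = 0 := by
  set B : Matrix ι ι R := Matrix.of fun l j => D j (g l) with hB
  set b : ι → R := Pi.single l 1
  -- `T j i` is the determinant with column `j` replaced by a basis vector and column `i` by second
  -- derivatives. The diagonal is zero because a derivation kills the constant column. As the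
  -- derivations commute, exchanging `i` and `j` exchanges two columns, so `T` is antisymmetric and
  -- its double sum equals its own negative; `h2` then makes that sum zero.
  set T : ι → ι → R := fun j i => if i = j then 0 else
    ((B.updateCol j b).updateCol i fun k => D j (D i (g k))).det with hT
  have hrow : ∀ j, D j (B.adjugate j l) = ∑ i, T j i := fun j => by
    rw [Matrix.adjugate_eq_det_updateCol, Derivation.map_det]
    refine Finset.sum_congr rfl fun i _ => ?_
    by_cases h : i = j
    · subst h
      simp only [hT, if_true]
      refine Matrix.det_eq_zero_of_column_eq_zero i fun k => ?_
      by_cases hk : k = l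
      · subst hk; simp
      · simp [hk]
    · simp only [hT, if_neg h]
      congr 2
      funext k
      simp [Matrix.updateCol_ne h, hB]
  have hanti : ∀ i j, T i j = - T j i := fun i j => by
    by_cases h : i = j
    · subst h; simp [hT]
    · simp only [hT, if_neg h, if_neg (Ne.symm h)]
      have := Matrix.det_permute' (Equiv.swap i j)
        ((B.updateCol j b).updateCol i fun k => D j (D i (g k)))
      rw [Equiv.Perm.sign_swap h] at this
      simp only [Units.val_neg, Units.val_one, Int.cast_neg, Int.cast_one, neg_mul, one_mul] at this
      rw [← this]
      congr 1
      ext k m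
      by_cases hm : m = i
      · subst hm
        simp [h, Ne.symm h]
      · by_cases hm' : m = j
        · subst hm'
          simp [hD i m]
        · simp [hm, hm', Equiv.swap_apply_of_ne_of_ne]
  simp only [hrow]
  have h3 : ∑ j, ∑ i, T j i = - ∑ j, ∑ i, T j i := by
    conv_lhs => rw [Finset.sum_comm]
    rw [← Finset.sum_neg_distrib]
    refine Finset.sum_congr rfl fun j _ => ?_
    rw [← Finset.sum_neg_distrib]
    exact Finset.sum_congr rfl fun i _ => hanti _ _
  refine h2 _ ?_
  nth_rw 1 [h3]
  simp

/-- The linearised determinant of a complex Hessian is symmetric up to a divergence. -/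
theorem Derivation.adjugate_hessian_symm (h2 : ∀ x : R, x + x = 0 → x = 0)
    (D E : ι → Derivation S R R)
    (hD : ∀ i j f, D i (D j f) = D j (D i f)) (hE : ∀ i j f, E i (E j f) = E j (E i f))
    (hDE : ∀ i j f, D i (E j f) = E j (D i f)) (v φ χ : R) :
    χ * ∑ j, ∑ l, (Matrix.of fun j l => D j (E l v)).adjugate l j * D j (E l φ) -
      φ * ∑ j, ∑ l, (Matrix.of fun j l => D j (E l v)).adjugate l j * D j (E l χ) =
    ∑ j, D j (χ * ∑ l, (Matrix.of fun j l => D j (E l v)).adjugate l j * E l φ) -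
      ∑ l, E l (∑ j, φ * (Matrix.of fun j l => D j (E l v)).adjugate l j * D j χ) := by
  set P := (Matrix.of fun j l => D j (E l v)).adjugate with hP
  -- Piola's identity in both indices: for the functions `E l v`, whose Jacobian under `D` is the
  -- transposed Hessian, and for `D l v` under `E`, where the mixed derivatives have to be
  -- exchanged.
  have hdD : ∀ l, ∑ j, D j (P l j) = 0 := fun l => by
    have := Derivation.sum_map_adjugate_eq_zero h2 D hD (fun l => E l v) l
    rw [← this, hP]
    refine Finset.sum_congr rfl fun j _ => ?_
    rw [← Matrix.transpose_apply (Matrix.adjugate _), Matrix.adjugate_transpose]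
    rfl
  have hdE : ∀ j, ∑ l, E l (P l j) = 0 := fun j => by
    have := Derivation.sum_map_adjugate_eq_zero h2 E hE (fun l => D l v) j
    rw [← this, hP]
    simp only [hDE]
  -- In the product rule the terms that differentiate `P` vanish by Piola. The first-order terms `P
  -- l j * E l φ * D j χ` are the same in `e1` and `e2` and cancel in the difference.
  have e1 : ∑ j, D j (χ * ∑ l, P l j * E l φ) = χ * ∑ j, ∑ l, P l j * D j (E l φ) +
      ∑ j, ∑ l, P l j * E l φ * D j χ := by
    simp only [Derivation.leibniz, map_sum, smul_eq_mul, Finset.sum_add_distrib, mul_add,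
      Finset.mul_sum]
    have : ∑ j, ∑ l, χ * (E l φ * D j (P l j)) = 0 := by
      rw [Finset.sum_comm]
      refine Finset.sum_eq_zero fun l _ => ?_
      simp only [← mul_assoc]
      rw [← Finset.mul_sum, hdD, mul_zero]
    rw [this, add_zero]
  have e2 : ∑ l, E l (∑ j, φ * P l j * D j χ) = φ * ∑ j, ∑ l, P l j * D j (E l χ) +
      ∑ j, ∑ l, P l j * E l φ * D j χ := by
    simp only [Derivation.leibniz, map_sum, smul_eq_mul, Finset.sum_add_distrib, mul_add,
      Finset.mul_sum]
    have : ∑ l, ∑ j, D j χ * (φ * E l (P l j)) = 0 := by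
      rw [Finset.sum_comm]
      refine Finset.sum_eq_zero fun j _ => ?_
      simp only [← mul_assoc]
      rw [← Finset.mul_sum, hdE, mul_zero]
    rw [this, zero_add]
    congr 1
    · rw [Finset.sum_comm]
      exact Finset.sum_congr rfl fun j _ => Finset.sum_congr rfl fun l _ => by rw [hDE]; ring
    · rw [Finset.sum_comm]
      exact Finset.sum_congr rfl fun j _ => Finset.sum_congr rfl fun l _ => by ring
  rw [e1, e2]
  ring

end Piola

/-! ### Wirtinger operators as commuting derivations of the algebra of smooth functions -/

noncomputable section WirtingerCalculus

theorem two_le_infty : minSmoothness ℝ 2 ≤ (∞ : ℕ∞ω) := by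
  rw [minSmoothness_of_isRCLikeNormedField]
  exact WithTop.coe_le_coe.2 (le_top : (2 : ℕ∞) ≤ ⊤)

/-- The algebra of smooth complex functions on a real normed space. -/
def smoothFunctions (E : Type*) [NormedAddCommGroup E] [NormedSpace ℝ E] :
    Subalgebra ℂ (E → ℂ) where
  carrier := {f | ContDiff ℝ ∞ f}
  mul_mem' := fun hf hg => ContDiff.mul (show ContDiff ℝ ∞ _ from hf) (show ContDiff ℝ ∞ _ from hg)
  add_mem' := fun hf hg => ContDiff.add (show ContDiff ℝ ∞ _ from hf) (show ContDiff ℝ ∞ _ from hg)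
  algebraMap_mem' := fun c => show ContDiff ℝ ∞ (fun _ => c) from contDiff_const

section Directional

variable {E : Type*} [NormedAddCommGroup E] [NormedSpace ℝ E]

theorem smoothFunctions_contDiff (f : smoothFunctions E) : ContDiff ℝ ∞ (f : E → ℂ) := f.2

theorem smoothFunctions_differentiableAt (f : smoothFunctions E) (p : E) :
    DifferentiableAt ℝ (f : E → ℂ) p :=
  (smoothFunctions_contDiff f).contDiffAt.differentiableAt (by simp)

/-- The directional derivative as a derivation of the algebra of smooth functions. -/
def dirDeriv (v : E) : Derivation ℂ (smoothFunctions E) (smoothFunctions E) :=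
  Derivation.mk'
    { toFun := fun f => ⟨fun p => fderiv ℝ (f : E → ℂ) p v,
        ((smoothFunctions_contDiff f).fderiv_right (m := ∞) (by simp)).clm_apply contDiff_const⟩
      map_add' := fun f g => by
        ext p
        simp [fderiv_add (smoothFunctions_differentiableAt f p)
          (smoothFunctions_differentiableAt g p)]
      map_smul' := fun c f => by
        ext p
        simp [fderiv_const_smul (smoothFunctions_differentiableAt f p)] }
    (fun f g => by
      ext p
      simp [fderiv_mul (smoothFunctions_differentiableAt f p)
        (smoothFunctions_differentiableAt g p)])

theorem dirDeriv_apply (v : E) (f : smoothFunctions E) (p : E) :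
    (dirDeriv v f : E → ℂ) p = fderiv ℝ (f : E → ℂ) p v := rfl

theorem dirDeriv_comm (v w : E) (f : smoothFunctions E) :
    dirDeriv v (dirDeriv w f) = dirDeriv w (dirDeriv v f) := by
  ext p
  have h2 : DifferentiableAt ℝ (fderiv ℝ (f : E → ℂ)) p :=
    ((smoothFunctions_contDiff f).fderiv_right (m := ∞)
      (by simp)).contDiffAt.differentiableAt (by simp)
  have key : ∀ a b : E, (dirDeriv a (dirDeriv b f) : E → ℂ) p =
      fderiv ℝ (fderiv ℝ (f : E → ℂ)) p a b := fun a b => by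
    rw [dirDeriv_apply]
    change fderiv ℝ (fun q => fderiv ℝ (f : E → ℂ) q b) p a = _
    rw [fderiv_clm_apply h2 (differentiableAt_const _)]
    simp
  rw [key, key]
  exact ((smoothFunctions_contDiff f).contDiffAt.isSymmSndFDerivAt two_le_infty).eq v w

end Directional

variable {n : ℕ}

/-- The Wirtinger derivative as a derivation. -/
def wirtDer (j : Fin n) : Derivation ℂ (smoothFunctions (Cn n)) (smoothFunctions (Cn n)) :=
  (1 / 2 : ℂ) • (dirDeriv (stdVec j) - Complex.I • dirDeriv (Complex.I • stdVec j))

/-- The conjugate Wirtinger derivative as a derivation. -/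
def wirtBarDer (j : Fin n) : Derivation ℂ (smoothFunctions (Cn n)) (smoothFunctions (Cn n)) :=
  (1 / 2 : ℂ) • (dirDeriv (stdVec j) + Complex.I • dirDeriv (Complex.I • stdVec j))

theorem coe_wirtDer (j : Fin n) (f : smoothFunctions (Cn n)) :
    (wirtDer j f : Cn n → ℂ) = wirtinger j (f : Cn n → ℂ) := rfl

theorem coe_wirtBarDer (j : Fin n) (f : smoothFunctions (Cn n)) :
    (wirtBarDer j f : Cn n → ℂ) = wirtingerBar j (f : Cn n → ℂ) := rfl

theorem wirtDer_apply (j : Fin n) (f : smoothFunctions (Cn n)) : wirtDer j f =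
    (1 / 2 : ℂ) • (dirDeriv (stdVec j) f - Complex.I • dirDeriv (Complex.I • stdVec j) f) := rfl

theorem wirtBarDer_apply (j : Fin n) (f : smoothFunctions (Cn n)) : wirtBarDer j f =
    (1 / 2 : ℂ) • (dirDeriv (stdVec j) f + Complex.I • dirDeriv (Complex.I • stdVec j) f) := rfl

theorem wirtDer_comm (i j : Fin n) (f : smoothFunctions (Cn n)) :
    wirtDer i (wirtDer j f) = wirtDer j (wirtDer i f) := by
  simp only [wirtDer_apply, Derivation.map_smul, Derivation.map_sub,
    dirDeriv_comm (stdVec i) (stdVec j), dirDeriv_comm (stdVec i) (Complex.I • stdVec j),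
    dirDeriv_comm (Complex.I • stdVec i) (stdVec j),
    dirDeriv_comm (Complex.I • stdVec i) (Complex.I • stdVec j)]
  module

theorem wirtBarDer_comm (i j : Fin n) (f : smoothFunctions (Cn n)) :
    wirtBarDer i (wirtBarDer j f) = wirtBarDer j (wirtBarDer i f) := by
  simp only [wirtBarDer_apply, Derivation.map_smul, Derivation.map_add,
    dirDeriv_comm (stdVec i) (stdVec j), dirDeriv_comm (stdVec i) (Complex.I • stdVec j),
    dirDeriv_comm (Complex.I • stdVec i) (stdVec j),
    dirDeriv_comm (Complex.I • stdVec i) (Complex.I • stdVec j)]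
  module

theorem wirtDer_wirtBarDer_comm (i j : Fin n) (f : smoothFunctions (Cn n)) :
    wirtDer i (wirtBarDer j f) = wirtBarDer j (wirtDer i f) := by
  simp only [wirtDer_apply, wirtBarDer_apply, Derivation.map_smul, Derivation.map_sub,
    Derivation.map_add,
    dirDeriv_comm (stdVec i) (stdVec j), dirDeriv_comm (stdVec i) (Complex.I • stdVec j),
    dirDeriv_comm (Complex.I • stdVec i) (stdVec j),
    dirDeriv_comm (Complex.I • stdVec i) (Complex.I • stdVec j)]
  module

/-- Integration by parts against the constant function `1`. -/
theorem integral_fderiv_apply_eq_zero {h : Cn n → ℂ} (hs : ContDiff ℝ ∞ h)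
    (hc : HasCompactSupport h) (v : Cn n) : ∫ p, fderiv ℝ h p v = 0 := by
  have hi : Integrable (fun p => fderiv ℝ h p v) :=
    ((hs.fderiv_right (m := ∞) (by simp)).clm_apply contDiff_const).continuous
      |>.integrable_of_hasCompactSupport (hc.fderiv_apply (𝕜 := ℝ) v)
  have := integral_mul_fderiv_eq_neg_fderiv_mul_of_integrable (μ := (volume : Measure (Cn n)))
    (f := fun _ => (1 : ℂ)) (g := h) (v := v) (by simp) (by simpa using hi)
    (by simpa using hs.continuous.integrable_of_hasCompactSupport hc) (by simp)
    (fun x _ => hs.contDiffAt.differentiableAt (by simp))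
  simpa using this

theorem integrable_fderiv_apply {h : Cn n → ℂ} (hs : ContDiff ℝ ∞ h)
    (hc : HasCompactSupport h) (v : Cn n) : Integrable (fun p => fderiv ℝ h p v) :=
  ((hs.fderiv_right (m := ∞) (by simp)).clm_apply contDiff_const).continuous
      |>.integrable_of_hasCompactSupport (hc.fderiv_apply (𝕜 := ℝ) v)

theorem integrable_wirtDer (j : Fin n) (h : smoothFunctions (Cn n))
    (hc : HasCompactSupport (h : Cn n → ℂ)) : Integrable (wirtDer j h : Cn n → ℂ) :=
  ((integrable_fderiv_apply h.2 hc _).sub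
    ((integrable_fderiv_apply h.2 hc _).const_mul _)).const_mul _

theorem integrable_wirtBarDer (j : Fin n) (h : smoothFunctions (Cn n))
    (hc : HasCompactSupport (h : Cn n → ℂ)) : Integrable (wirtBarDer j h : Cn n → ℂ) :=
  ((integrable_fderiv_apply h.2 hc _).add
    ((integrable_fderiv_apply h.2 hc _).const_mul _)).const_mul _

theorem integral_wirtDer (j : Fin n) (h : smoothFunctions (Cn n))
    (hc : HasCompactSupport (h : Cn n → ℂ)) : ∫ p, (wirtDer j h : Cn n → ℂ) p = 0 := by
  rw [coe_wirtDer]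
  simp only [wirtinger]
  rw [integral_const_mul, integral_sub, integral_const_mul, integral_fderiv_apply_eq_zero h.2 hc,
    integral_fderiv_apply_eq_zero h.2 hc]
  · simp
  · exact integrable_fderiv_apply h.2 hc _
  · exact (integrable_fderiv_apply h.2 hc _).const_mul _

theorem integral_wirtBarDer (j : Fin n) (h : smoothFunctions (Cn n))
    (hc : HasCompactSupport (h : Cn n → ℂ)) : ∫ p, (wirtBarDer j h : Cn n → ℂ) p = 0 := by
  rw [coe_wirtBarDer]
  simp only [wirtingerBar]
  rw [integral_const_mul, integral_add, integral_const_mul, integral_fderiv_apply_eq_zero h.2 hc,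
    integral_fderiv_apply_eq_zero h.2 hc]
  · simp
  · exact integrable_fderiv_apply h.2 hc _
  · exact (integrable_fderiv_apply h.2 hc _).const_mul _

end WirtingerCalculus

/-! ### Positive semidefinite matrices and complex Hessians -/

noncomputable section HessianForms

section PosSemidef

open scoped ComplexOrder MatrixOrder Matrix.Norms.L2Operator

theorem Matrix.PosSemidef.diag_re_nonneg {ι : Type*} {A : Matrix ι ι ℂ} (hA : A.PosSemidef)
    (i : ι) : 0 ≤ (A i i).re :=
  (Complex.nonneg_iff.1 (hA.diag_nonneg (i := i))).1

variable {ι : Type*} [Fintype ι] [DecidableEq ι]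

theorem Matrix.PosSemidef.exists_eq_conjTranspose_mul_self {A : Matrix ι ι ℂ}
    (hA : A.PosSemidef) : ∃ B : Matrix ι ι ℂ, A = B.conjTranspose * B :=
  CStarAlgebra.nonneg_iff_eq_star_mul_self.1 hA.nonneg

/-- The adjugate reverses products and commutes with the conjugate transpose, so a factorisation `A
= Bᴴ B` yields one of the adjugate. -/
theorem Matrix.PosSemidef.adjugate {A : Matrix ι ι ℂ} (hA : A.PosSemidef) :
    A.adjugate.PosSemidef := by
  obtain ⟨B, rfl⟩ := hA.exists_eq_conjTranspose_mul_self
  rw [Matrix.adjugate_mul_distrib, ← Matrix.adjugate_conjTranspose]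
  exact Matrix.posSemidef_self_mul_conjTranspose _

theorem Matrix.PosSemidef.det_re_nonneg {A : Matrix ι ι ℂ} (hA : A.PosSemidef) :
    0 ≤ A.det.re :=
  (Complex.nonneg_iff.1 hA.det_nonneg).1

theorem Matrix.PosSemidef.det_im {A : Matrix ι ι ℂ} (hA : A.PosSemidef) :
    A.det.im = 0 :=
  (Complex.nonneg_iff.1 hA.det_nonneg).2.symm

/-- The entries of a positive semidefinite matrix are bounded by its trace. -/
theorem Matrix.PosSemidef.norm_apply_le {A : Matrix ι ι ℂ} (hA : A.PosSemidef) (i j : ι) :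
    ‖A i j‖ ≤ ∑ k, (A k k).re := by
  obtain ⟨B, rfl⟩ := hA.exists_eq_conjTranspose_mul_self
  have hdiag : ∀ i, ((B.conjTranspose * B) i i).re = ∑ k, ‖B k i‖ ^ 2 := fun i => by
    simp only [Matrix.mul_apply, Matrix.conjTranspose_apply, Complex.re_sum]
    refine Finset.sum_congr rfl fun k _ => ?_
    rw [Complex.star_def, ← Complex.normSq_eq_conj_mul_self, Complex.ofReal_re,
      Complex.normSq_eq_norm_sq]
  have hle : ∀ i, ∑ k, ‖B k i‖ ^ 2 ≤ ∑ m, ((B.conjTranspose * B) m m).re := fun i => by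
    rw [← hdiag i]
    exact Finset.single_le_sum (f := fun m => ((B.conjTranspose * B) m m).re)
      (fun m _ => hA.diag_re_nonneg m) (Finset.mem_univ i)
  have : ‖(B.conjTranspose * B) i j‖ ≤ ∑ k, (‖B k i‖ ^ 2 + ‖B k j‖ ^ 2) / 2 := by
    rw [Matrix.mul_apply]
    refine (norm_sum_le _ _).trans (Finset.sum_le_sum fun k _ => ?_)
    rw [norm_mul, Matrix.conjTranspose_apply, norm_star]
    nlinarith [sq_nonneg (‖B k i‖ - ‖B k j‖)]
  refine this.trans ?_
  rw [← Finset.sum_div, Finset.sum_add_distrib]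
  linarith [hle i, hle j]

/-- Reduces the pairing with an arbitrary bounded matrix to the trace of `A`, which for adjugates of
Hessians is what the Chern-Levine-Nirenberg inequality controls. -/
theorem Matrix.PosSemidef.norm_sum_mul_le {A : Matrix ι ι ℂ} (hA : A.PosSemidef)
    (B : Matrix ι ι ℂ) {b : ℝ} (hb : ∀ i j, ‖B i j‖ ≤ b) :
    ‖∑ j, ∑ l, A l j * B j l‖ ≤ (Fintype.card ι : ℝ) ^ 2 * b * ∑ k, (A k k).re := by
  calc ‖∑ j, ∑ l, A l j * B j l‖ ≤ ∑ j : ι, ∑ l : ι, (∑ k, (A k k).re) * b := by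
        refine (norm_sum_le _ _).trans (Finset.sum_le_sum fun j _ => ?_)
        refine (norm_sum_le _ _).trans (Finset.sum_le_sum fun l _ => ?_)
        rw [norm_mul]
        exact mul_le_mul (hA.norm_apply_le l j) (hb j l) (norm_nonneg _)
          (Finset.sum_nonneg fun k _ => hA.diag_re_nonneg k)
    _ = _ := by simp; ring

/-- The determinant is monotone on positive semidefinite matrices. -/
theorem Matrix.PosSemidef.det_re_le_det_add {A B : Matrix ι ι ℂ} (hA : A.PosSemidef)
    (hB : B.PosSemidef) : A.det.re ≤ (A + B).det.re := by
  -- Evaluating the characteristic polynomial at `-1` gives `det(1 + P) = ∏ (1 + λᵢ)` with all `λᵢ ≥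
  -- 0`.
  have one_add : ∀ {P : Matrix ι ι ℂ}, P.PosSemidef → 1 ≤ (1 + P).det.re := fun {P} hP => by
    have h1 : (1 + P).det = ∏ i, ((1 + hP.1.eigenvalues i : ℝ) : ℂ) := by
      have h := congrArg (Polynomial.eval (-1 : ℂ)) hP.1.charpoly_eq
      rw [Matrix.eval_charpoly, Polynomial.eval_prod] at h
      have h2 : Matrix.scalar ι (-1 : ℂ) - P = - (1 + P) := by
        rw [map_neg, map_one]; abel
      rw [h2, Matrix.det_neg] at h
      have h3 : ∏ i, Polynomial.eval (-1 : ℂ)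
          (Polynomial.X - Polynomial.C ((hP.1.eigenvalues i : ℝ) : ℂ)) =
          (-1) ^ Fintype.card ι * ∏ i, ((1 + hP.1.eigenvalues i : ℝ) : ℂ) := by
        rw [Fintype.card, ← Finset.prod_const, ← Finset.prod_mul_distrib]
        refine Finset.prod_congr rfl fun i _ => ?_
        simp; ring
      have h4 := h.trans h3
      exact mul_left_cancel₀ (pow_ne_zero _ (by norm_num)) h4
    rw [h1, ← Complex.ofReal_prod, Complex.ofReal_re]
    calc (1 : ℝ) = ∏ i : ι, 1 := by simp
      _ ≤ _ := Finset.prod_le_prod (fun _ _ => zero_le_one)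
        fun i _ => by linarith [hP.eigenvalues_nonneg i]
  obtain ⟨S, hS⟩ := hA.exists_eq_conjTranspose_mul_self
  by_cases hdet : S.det = 0
  · have : A.det = 0 := by rw [hS, Matrix.det_mul, hdet, mul_zero]
    rw [this]
    exact (hA.add hB).det_re_nonneg
  · have hu : IsUnit S.det := isUnit_iff_ne_zero.2 hdet
    have hu' : IsUnit S.conjTranspose.det := by
      rw [Matrix.det_conjTranspose]; exact hu.star
    -- For invertible `S` the congruence by `S` reduces the claim to `A = 1`: `A + B = Sᴴ (1 + P)
    -- S`.
    set P := (S⁻¹).conjTranspose * B * S⁻¹ with hP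
    have hPp : P.PosSemidef := hB.conjTranspose_mul_mul_same _
    have hAB : A + B = S.conjTranspose * (1 + P) * S := by
      rw [hS, hP, Matrix.mul_add, Matrix.add_mul, Matrix.mul_one]
      congr 1
      rw [Matrix.conjTranspose_nonsing_inv]
      simp only [Matrix.mul_assoc]
      rw [Matrix.nonsing_inv_mul _ hu, Matrix.mul_one, Matrix.mul_nonsing_inv_cancel_left _ _ hu']
    have hdetA : A.det = ((Complex.normSq S.det : ℝ) : ℂ) := by
      rw [hS, Matrix.det_mul, Matrix.det_conjTranspose, Complex.star_def,
        Complex.normSq_eq_conj_mul_self]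
    have : (A + B).det = ((Complex.normSq S.det : ℝ) : ℂ) * (1 + P).det := by
      rw [← hdetA, hAB, hS, Matrix.det_mul, Matrix.det_mul, Matrix.det_mul]; ring
    rw [this, Complex.re_ofReal_mul, hdetA, Complex.ofReal_re]
    exact le_mul_of_one_le_right (Complex.normSq_nonneg _) (one_add hPp)

end PosSemidef

variable {n : ℕ}

theorem wirtinger_congr {f g : Cn n → ℂ} {p : Cn n} (h : f =ᶠ[𝓝 p] g) (j : Fin n) :
    wirtinger j f =ᶠ[𝓝 p] wirtinger j g := by
  filter_upwards [h.fderiv (𝕜 := ℝ)] with q hq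
  simp only [wirtinger, hq]

theorem wirtingerBar_congr {f g : Cn n → ℂ} {p : Cn n} (h : f =ᶠ[𝓝 p] g) (j : Fin n) :
    wirtingerBar j f =ᶠ[𝓝 p] wirtingerBar j g := by
  filter_upwards [h.fderiv (𝕜 := ℝ)] with q hq
  simp only [wirtingerBar, hq]

theorem complexHessian_congr {u v : Cn n → ℝ} {p : Cn n} (h : u =ᶠ[𝓝 p] v) :
    complexHessian u p = complexHessian v p := by
  ext j k
  have h1 : (fun w => (u w : ℂ)) =ᶠ[𝓝 p] fun w => (v w : ℂ) := by
    filter_upwards [h] with q hq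
    rw [hq]
  exact (wirtinger_congr (wirtingerBar_congr h1 k) j).self_of_nhds

theorem mongeAmpereDensity_congr {u v : Cn n → ℝ} {p : Cn n} (h : u =ᶠ[𝓝 p] v) :
    mongeAmpereDensity u p = mongeAmpereDensity v p := by
  simp only [mongeAmpereDensity, complexHessian_congr h]

/-- A smooth real function as an element of the algebra of smooth complex functions. -/
def smoothOfReal (u : Cn n → ℝ) (hu : ContDiff ℝ ∞ u) : smoothFunctions (Cn n) :=
  ⟨fun w => (u w : ℂ), Complex.ofRealCLM.contDiff.comp hu⟩

theorem complexHessian_apply (u : Cn n → ℝ) (hu : ContDiff ℝ ∞ u) (p : Cn n) (j k : Fin n) :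
    complexHessian u p j k = (wirtDer j (wirtBarDer k (smoothOfReal u hu)) : Cn n → ℂ) p := rfl

/-- The Hessian along the coordinates selected by `e`. -/
def subHessian {k : ℕ} (e : Fin k → Fin n) (u : Cn n → ℝ) (p : Cn n) :
    Matrix (Fin k) (Fin k) ℂ := (complexHessian u p).submatrix e e

theorem contDiff_complexHessian {u : Cn n → ℝ} (hu : ContDiff ℝ ∞ u) (j k : Fin n) :
    ContDiff ℝ ∞ fun p => complexHessian u p j k :=
  smoothFunctions_contDiff (wirtDer j (wirtBarDer k (smoothOfReal u hu)))

theorem continuous_complexHessian {u : Cn n → ℝ} (hu : ContDiff ℝ ∞ u) :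
    Continuous (complexHessian u) :=
  continuous_matrix fun j k => (contDiff_complexHessian hu j k).continuous

theorem continuous_subHessian {k : ℕ} (e : Fin k → Fin n) {u : Cn n → ℝ}
    (hu : ContDiff ℝ ∞ u) : Continuous (subHessian e u) :=
  (continuous_complexHessian hu).matrix_submatrix e e

theorem complexHessian_add {u v : Cn n → ℝ} (hu : ContDiff ℝ ∞ u) (hv : ContDiff ℝ ∞ v)
    (p : Cn n) :
    complexHessian (fun z => u z + v z) p = complexHessian u p + complexHessian v p := by
  ext j k
  have : smoothOfReal (fun z => u z + v z) (hu.add hv) = smoothOfReal u hu + smoothOfReal v hv := by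
    ext p; simp [smoothOfReal]
  rw [complexHessian_apply _ (hu.add hv), this, map_add, map_add, Matrix.add_apply,
    complexHessian_apply _ hu, complexHessian_apply _ hv]
  rfl

theorem complexHessian_const_mul (c : ℝ) {u : Cn n → ℝ} (hu : ContDiff ℝ ∞ u)
    (p : Cn n) : complexHessian (fun z => c * u z) p = (c : ℂ) • complexHessian u p := by
  ext j k
  have : smoothOfReal (fun z => c * u z) (contDiff_const.mul hu) = (c : ℂ) • smoothOfReal u hu := by
    ext p; simp [smoothOfReal]
  rw [complexHessian_apply _ (contDiff_const.mul hu), this, Derivation.map_smul,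
    Derivation.map_smul, Matrix.smul_apply, complexHessian_apply _ hu]
  rfl

theorem complexHessian_const (c : ℝ) (p : Cn n) :
    complexHessian (fun _ : Cn n => c) p = 0 := by
  ext j k
  have : smoothOfReal (n := n) (fun _ => c) contDiff_const = algebraMap ℂ _ (c : ℂ) := rfl
  rw [complexHessian_apply _ contDiff_const, this, Derivation.map_algebraMap, map_zero]
  rfl

theorem complexHessian_eq_zero_of_notMem_tsupport {u : Cn n → ℝ} {p : Cn n}
    (hp : p ∉ tsupport u) : complexHessian u p = 0 := by
  rw [complexHessian_congr (notMem_tsupport_iff_eventuallyEq.1 hp)]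
  exact complexHessian_const 0 p

/-- Integration by parts for the linearised Monge-Ampère operator. -/
theorem integral_adjugate_subHessian_symm {k : ℕ} (e : Fin k → Fin n) {v φ χ : Cn n → ℝ}
    (hv : ContDiff ℝ ∞ v) (hφ : ContDiff ℝ ∞ φ) (hχ : ContDiff ℝ ∞ χ)
    (hc : HasCompactSupport χ) :
    ∫ p, (χ p : ℂ) * ∑ j, ∑ l, (subHessian e v p).adjugate l j * subHessian e φ p j l =
      ∫ p, (φ p : ℂ) * ∑ j, ∑ l, (subHessian e v p).adjugate l j * subHessian e χ p j l := by
  set V := smoothOfReal v hv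
  set Φ := smoothOfReal φ hφ
  set X := smoothOfReal χ hχ with hX
  set D : Fin k → Derivation ℂ (smoothFunctions (Cn n)) (smoothFunctions (Cn n)) :=
    fun j => wirtDer (e j)
  set E : Fin k → Derivation ℂ (smoothFunctions (Cn n)) (smoothFunctions (Cn n)) :=
    fun j => wirtBarDer (e j)
  have key := Derivation.adjugate_hessian_symm (R := smoothFunctions (Cn n))
    (fun x hx => by
      ext p
      have := congrFun (congrArg Subtype.val hx) p
      have h2 : (x : Cn n → ℂ) p + (x : Cn n → ℂ) p = 0 := this
      exact add_self_eq_zero.1 h2) D E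
    (fun i j f => wirtDer_comm _ _ _) (fun i j f => wirtBarDer_comm _ _ _)
    (fun i j f => wirtDer_wirtBarDer_comm _ _ _) V Φ X
  set P := (Matrix.of fun j l => D j (E l V)).adjugate with hP
  -- Evaluation at `p` is a ring homomorphism, hence commutes with the adjugate.
  have hPp : ∀ p l j, (P l j : Cn n → ℂ) p = (subHessian e v p).adjugate l j := fun p l j => by
    set ev : smoothFunctions (Cn n) →+* ℂ :=
      (Pi.evalRingHom (fun _ : Cn n => ℂ) p).comp (smoothFunctions (Cn n)).val.toRingHom with hev
    have := congrFun (congrFun (ev.map_adjugate (Matrix.of fun j l => D j (E l V))) l) j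
    exact this
  have hcX : ∀ p ∉ tsupport χ, (X : Cn n → ℂ) p = 0 := fun p hp => by
    change ((χ p : ℝ) : ℂ) = 0
    rw [image_eq_zero_of_notMem_tsupport hp, Complex.ofReal_zero]
  have hcDX : ∀ j, ∀ p ∉ tsupport χ, (D j X : Cn n → ℂ) p = 0 := fun j p hp => by
    have h0 : (X : Cn n → ℂ) =ᶠ[𝓝 p] fun _ => 0 := by
      filter_upwards [notMem_tsupport_iff_eventuallyEq.1 hp] with q hq
      change ((χ q : ℝ) : ℂ) = 0
      rw [hq]; simp
    change wirtinger (e j) (X : Cn n → ℂ) p = 0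
    rw [(wirtinger_congr h0 (e j)).self_of_nhds]
    simp [wirtinger]
  set F : smoothFunctions (Cn n) := X * ∑ j, ∑ l, P l j * D j (E l Φ)
  set G : smoothFunctions (Cn n) := Φ * ∑ j, ∑ l, P l j * D j (E l X)
  have hF : ∀ p, (F : Cn n → ℂ) p =
      (χ p : ℂ) * ∑ j, ∑ l, (subHessian e v p).adjugate l j * subHessian e φ p j l := fun p => by
    simp only [F, MulMemClass.coe_mul, AddSubmonoidClass.coe_finsetSum, Pi.mul_apply,
      Finset.sum_apply, hPp]
    rfl
  have hG : ∀ p, (G : Cn n → ℂ) p =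
      (φ p : ℂ) * ∑ j, ∑ l, (subHessian e v p).adjugate l j * subHessian e χ p j l := fun p => by
    simp only [G, MulMemClass.coe_mul, AddSubmonoidClass.coe_finsetSum, Pi.mul_apply,
      Finset.sum_apply, hPp]
    rfl
  have hFi : Integrable (F : Cn n → ℂ) :=
    (smoothFunctions_contDiff F).continuous.integrable_of_hasCompactSupport
      (HasCompactSupport.intro hc.isCompact fun p hp => by
        rw [hF, image_eq_zero_of_notMem_tsupport hp, Complex.ofReal_zero, zero_mul])
  have hGi : Integrable (G : Cn n → ℂ) :=
    (smoothFunctions_contDiff G).continuous.integrable_of_hasCompactSupport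
      (HasCompactSupport.intro hc.isCompact fun p hp => by
        rw [hG]
        simp [subHessian, complexHessian_eq_zero_of_notMem_tsupport hp])
  simp only [← hF, ← hG]
  rw [← sub_eq_zero, ← integral_sub hFi hGi]
  -- The difference of the integrands is a sum of derivatives of functions each carrying a factor
  -- `χ` or `D j χ`. These have compact support although `v` and `φ` need not, so every integral
  -- vanishes.
  have hkey : ∀ p, (F : Cn n → ℂ) p - (G : Cn n → ℂ) p =
      ∑ j, (D j (X * ∑ l, P l j * E l Φ) : Cn n → ℂ) p -
        ∑ l, (E l (∑ j, Φ * P l j * D j X) : Cn n → ℂ) p := fun p => by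
    have h1 := congrFun (congrArg Subtype.val key) p
    simpa only [AddSubgroupClass.coe_sub, AddSubmonoidClass.coe_finsetSum, Pi.sub_apply,
      Finset.sum_apply] using h1
  simp only [hkey]
  have hc1 : ∀ j, HasCompactSupport
      ((X * ∑ l, P l j * E l Φ : smoothFunctions (Cn n)) : Cn n → ℂ) :=
    fun j => HasCompactSupport.intro hc.isCompact fun p hp => by
      simp [hcX p hp]
  have hc2 : ∀ l, HasCompactSupport
      ((∑ j, Φ * P l j * D j X : smoothFunctions (Cn n)) : Cn n → ℂ) :=
    fun l => HasCompactSupport.intro hc.isCompact fun p hp => by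
      simp [hcDX _ p hp]
  have hi1 : ∀ j, Integrable (D j (X * ∑ l, P l j * E l Φ) : Cn n → ℂ) := fun j =>
    integrable_wirtDer _ _ (hc1 j)
  have hi2 : ∀ l, Integrable (E l (∑ j, Φ * P l j * D j X) : Cn n → ℂ) := fun l =>
    integrable_wirtBarDer _ _ (hc2 l)
  rw [integral_sub (integrable_finsetSum _ fun j _ => hi1 j)
    (integrable_finsetSum _ fun l _ => hi2 l), integral_finsetSum _ fun j _ => hi1 j,
    integral_finsetSum _ fun l _ => hi2 l]
  rw [Finset.sum_eq_zero fun j _ => integral_wirtDer _ _ (hc1 j),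
    Finset.sum_eq_zero fun l _ => integral_wirtBarDer _ _ (hc2 l), sub_zero]

end HessianForms

/-! ### The Chern-Levine-Nirenberg inequality -/

noncomputable section ChernLevineNirenberg

open scoped ComplexOrder

theorem exists_smooth_cutoff {E : Type*} [NormedAddCommGroup E] [NormedSpace ℝ E]
    [FiniteDimensional ℝ E] {K U : Set E} (hK : IsCompact K) (hU : IsOpen U) (hKU : K ⊆ U) :
    ∃ χ : E → ℝ, ContDiff ℝ ∞ χ ∧ HasCompactSupport χ ∧ tsupport χ ⊆ U ∧
      (∀ᶠ x in 𝓝ˢ K, χ x = 1) ∧ ∀ x, χ x ∈ Icc (0 : ℝ) 1 := by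
  obtain ⟨L, hL, hKL, hLU⟩ := exists_compact_between hK hU hKU
  obtain ⟨f, h1, h0, hf⟩ := exists_contMDiffMap_one_nhds_of_subset_interior
    (n := ⊤) (modelWithCornersSelf ℝ E) hK.isClosed hKL
  have hsub : tsupport f ⊆ L :=
    closure_minimal (fun x hx => by_contra fun h => hx (h0 x h)) hL.isClosed
  exact ⟨f, f.contMDiff.contDiff, HasCompactSupport.of_support_subset_isCompact hL
    ((subset_tsupport _).trans hsub), hsub.trans hLU, h1, hf⟩

variable {n : ℕ}

/-- `v` is smooth, plurisubharmonic on `V` in the sense of its Hessian, and bounded by `M` there. -/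
structure IsSmoothPSH (V : Set (Cn n)) (M : ℝ) (v : Cn n → ℝ) : Prop where
  contDiff : ContDiff ℝ ∞ v
  posSemidef : ∀ p ∈ V, (complexHessian v p).PosSemidef
  bound : ∀ p ∈ V, |v p| ≤ M

theorem IsSmoothPSH.subHessian {V : Set (Cn n)} {M : ℝ} {v : Cn n → ℝ} (hv : IsSmoothPSH V M v)
    {k : ℕ} (e : Fin k → Fin n) {p : Cn n} (hp : p ∈ V) : (subHessian e v p).PosSemidef :=
  (hv.posSemidef p hp).submatrix e

/-- The trace of the adjugate of the Hessian along the coordinates selected by `e`. -/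
def traceAdj {k : ℕ} (e : Fin k → Fin n) (v : Cn n → ℝ) (p : Cn n) : ℝ :=
  ∑ i, ((subHessian e v p).adjugate i i).re

theorem continuous_traceAdj {k : ℕ} (e : Fin k → Fin n) {v : Cn n → ℝ} (hv : ContDiff ℝ ∞ v) :
    Continuous (traceAdj e v) := by
  refine continuous_finsetSum _ fun i _ => Complex.continuous_re.comp ?_
  exact (continuous_subHessian e hv).matrix_adjugate.matrix_elem i i

theorem exists_bound_subHessian {χ : Cn n → ℝ} (hχ : ContDiff ℝ ∞ χ) (hc : HasCompactSupport χ) :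
    ∃ b : ℝ, 0 ≤ b ∧ ∀ p i j, ‖complexHessian χ p i j‖ ≤ b := by
  have h1 : ∀ i j, ∃ b : ℝ, ∀ p, ‖complexHessian χ p i j‖ ≤ b := fun i j => by
    obtain ⟨b, hb⟩ := (HasCompactSupport.intro (f := fun p => complexHessian χ p i j) hc.isCompact
      fun p hp => by simp [complexHessian_eq_zero_of_notMem_tsupport hp]).exists_bound_of_continuous
        (contDiff_complexHessian hχ i j).continuous
    exact ⟨b, hb⟩
  choose b hb using h1
  refine ⟨∑ i, ∑ j, |b i j|, Finset.sum_nonneg fun i _ => Finset.sum_nonneg fun j _ => abs_nonneg _,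
    fun p i j => ?_⟩
  calc ‖complexHessian χ p i j‖ ≤ |b i j| := (hb i j p).trans (le_abs_self _)
    _ ≤ ∑ j, |b i j| := Finset.single_le_sum (f := fun j => |b i j|)
      (fun j _ => abs_nonneg _) (Finset.mem_univ j)
    _ ≤ _ := Finset.single_le_sum (f := fun i => ∑ j, |b i j|)
      (fun i _ => Finset.sum_nonneg fun j _ => abs_nonneg _) (Finset.mem_univ i)

/-- Integration by parts takes the Hessian off `φ`, of which only the size is known, and puts it on
the cutoff `χ`. Used with `φ = v` for the Chern-Levine-Nirenberg inequality and with `φ` a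
difference of two functions for stability. -/
theorem norm_integral_adjugate_le {V : Set (Cn n)} {M m b : ℝ} {v φ χ : Cn n → ℝ}
    {k : ℕ} (e : Fin k → Fin n) (hv : IsSmoothPSH V M v) (hφ : ContDiff ℝ ∞ φ)
    (hφm : ∀ p ∈ V, |φ p| ≤ m) (hχ : ContDiff ℝ ∞ χ) (hc : HasCompactSupport χ)
    (hV : tsupport χ ⊆ V) (hb : ∀ p i j, ‖complexHessian χ p i j‖ ≤ b) :
    ‖∫ p, (χ p : ℂ) * ∑ j, ∑ l, (subHessian e v p).adjugate l j * subHessian e φ p j l‖ ≤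
      m * ((k : ℝ) ^ 2 * b) * ∫ p in tsupport χ, traceAdj e v p := by
  rw [integral_adjugate_subHessian_symm e hv.contDiff hφ hχ hc]
  have hint : IntegrableOn (traceAdj e v) (tsupport χ) :=
    (continuous_traceAdj e hv.contDiff).continuousOn.integrableOn_compact hc.isCompact
  rw [← setIntegral_eq_integral_of_forall_compl_eq_zero (s := tsupport χ)]
  · rw [← integral_const_mul]
    refine norm_integral_le_of_norm_le (hint.const_mul _) ?_
    refine (ae_restrict_iff' (isClosed_tsupport χ).measurableSet).2 (Eventually.of_forall ?_)
    intro p hp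
    rw [norm_mul, Complex.norm_real, Real.norm_eq_abs, mul_assoc]
    refine mul_le_mul (hφm p (hV hp)) ?_ (norm_nonneg _) ((abs_nonneg _).trans (hφm p (hV hp)))
    have := (hv.subHessian e (hV hp)).adjugate.norm_sum_mul_le (subHessian e χ p)
      (b := b) (fun i j => hb p _ _)
    simpa [traceAdj] using this
  · intro p hp
    simp [subHessian, complexHessian_eq_zero_of_notMem_tsupport hp]

/-- Diagonal entries of the adjugate are principal minors, that is, Hessian determinants in one
variable fewer. This drives the induction on the number of variables, and is why Hessians along
selected coordinates appear. -/
theorem traceAdj_succ {k : ℕ} (e : Fin (k + 1) → Fin n) (v : Cn n → ℝ) (p : Cn n) :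
    traceAdj e v p = ∑ i : Fin (k + 1), (subHessian (e ∘ i.succAbove) v p).det.re := by
  refine Finset.sum_congr rfl fun i _ => ?_
  rw [Matrix.adjugate_fin_succ_eq_det_submatrix, ← two_mul, pow_mul]
  simp [subHessian, Matrix.submatrix_submatrix]

theorem continuous_det_subHessian {k : ℕ} (e : Fin k → Fin n) {v : Cn n → ℝ}
    (hv : ContDiff ℝ ∞ v) : Continuous fun p => (subHessian e v p).det :=
  (continuous_subHessian e hv).matrix_det

/-- The Chern-Levine-Nirenberg inequality for smooth plurisubharmonic functions. -/
theorem exists_integral_det_subHessian_le {V : Set (Cn n)} (hV : IsOpen V) (M : ℝ) (k : ℕ) :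
    ∀ (e : Fin k → Fin n) (K : Set (Cn n)), IsCompact K → K ⊆ V →
      ∃ C : ℝ, 0 ≤ C ∧ ∀ v, IsSmoothPSH V M v → ∫ p in K, (subHessian e v p).det.re ≤ C := by
  -- The coordinates `e` and the compact set `K` stay general: the inductive step passes to minors
  -- and from `K` to the larger support of a cutoff.
  induction k with
  | zero =>
    intro e K hK hKV
    exact ⟨volume.real K, measureReal_nonneg, fun v hv => by simp⟩
  | succ k ih =>
    intro e K hK hKV
    obtain ⟨χ, hχ, hc, hcV, h1, h01⟩ := exists_smooth_cutoff hK hV hKV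
    obtain ⟨b, hb0, hb⟩ := exists_bound_subHessian hχ hc
    choose C hC0 hC using fun i : Fin (k + 1) =>
      ih (e ∘ i.succAbove) (tsupport χ) hc.isCompact hcV
    refine ⟨|M| * (((k + 1 : ℕ) : ℝ) ^ 2 * b) * ∑ i, C i, by
      have := Finset.sum_nonneg fun i (_ : i ∈ Finset.univ) => hC0 i
      positivity, fun v hv => ?_⟩
    have htr : ∫ p in tsupport χ, traceAdj e v p ≤ ∑ i, C i := by
      simp only [traceAdj_succ]
      rw [integral_finsetSum]
      · exact Finset.sum_le_sum fun i _ => hC i v hv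
      · intro i _
        exact (Complex.continuous_re.comp (continuous_det_subHessian _ hv.contDiff)).continuousOn
          |>.integrableOn_compact hc.isCompact
    -- The choice `φ = v` makes the left side an integral of the determinant itself, by `hsum`: the
    -- trace of `adj(H) H` is `(k + 1) det H`. The factor `k + 1 ≥ 1` is discarded at the end.
    have hmain := norm_integral_adjugate_le (m := |M|) e hv hv.contDiff
      (fun p hp => (hv.bound p hp).trans (le_abs_self _)) hχ hc hcV hb
    have hsum : ∀ p, ∑ j, ∑ l, (subHessian e v p).adjugate l j * subHessian e v p j l =
        ((k + 1 : ℕ) : ℂ) * (subHessian e v p).det := fun p => by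
      have : ∀ j, ∑ l, (subHessian e v p).adjugate l j * subHessian e v p j l =
          (subHessian e v p).det := fun j => by
        have := congrFun (congrFun (Matrix.mul_adjugate (subHessian e v p)) j) j
        simp only [Matrix.mul_apply, Matrix.smul_apply, Matrix.one_apply_eq, smul_eq_mul,
          mul_one] at this
        rw [← this]
        exact Finset.sum_congr rfl fun l _ => mul_comm _ _
      simp [this]
    simp only [hsum] at hmain
    have hdet_cont := continuous_det_subHessian e hv.contDiff
    have hreal : ∀ p, (χ p : ℂ) * (((k + 1 : ℕ) : ℂ) * (subHessian e v p).det) =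
        (((k + 1 : ℕ) : ℝ) * (χ p * (subHessian e v p).det.re) : ℝ) := fun p => by
      by_cases hp : p ∈ tsupport χ
      · have him := (hv.subHessian e (hcV hp)).det_im
        have : (subHessian e v p).det = ((subHessian e v p).det.re : ℂ) :=
          Complex.ext (by simp) (by simp [him])
        rw [this]
        push_cast
        simp only [Complex.ofReal_re]
        ring
      · simp [image_eq_zero_of_notMem_tsupport hp]
    simp only [hreal] at hmain
    rw [integral_complex_ofReal, Complex.norm_real, integral_const_mul] at hmain
    have hχint : Integrable fun p => χ p * (subHessian e v p).det.re :=
      (hχ.continuous.mul (Complex.continuous_re.comp hdet_cont)).integrable_of_hasCompactSupport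
        hc.mul_right
    have hχnn : ∀ p, 0 ≤ χ p * (subHessian e v p).det.re := fun p => by
      by_cases hp : p ∈ tsupport χ
      · exact mul_nonneg (h01 p).1 (hv.subHessian e (hcV hp)).det_re_nonneg
      · simp [image_eq_zero_of_notMem_tsupport hp]
    have hle : ∫ p in K, (subHessian e v p).det.re ≤ ∫ p, χ p * (subHessian e v p).det.re := by
      have h2 : ∫ p in K, (subHessian e v p).det.re = ∫ p in K, χ p * (subHessian e v p).det.re :=
        setIntegral_congr_fun hK.measurableSet fun p hp => by
          simp only [h1.self_of_nhdsSet p hp, one_mul]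
      rw [h2]
      exact setIntegral_le_integral hχint (Eventually.of_forall hχnn)
    have hI : 0 ≤ ∫ p, χ p * (subHessian e v p).det.re := integral_nonneg hχnn
    have h3 : ∫ p, χ p * (subHessian e v p).det.re ≤
        ‖((k + 1 : ℕ) : ℝ) * ∫ p, χ p * (subHessian e v p).det.re‖ := by
      rw [Real.norm_of_nonneg (by positivity)]
      refine le_mul_of_one_le_left hI ?_
      push_cast
      linarith [(Nat.cast_nonneg k : (0 : ℝ) ≤ k)]
    refine hle.trans (h3.trans (hmain.trans ?_))
    exact mul_le_mul_of_nonneg_left htr (by positivity)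

theorem exists_integral_traceAdj_le {V : Set (Cn n)} (hV : IsOpen V) (M : ℝ) {k : ℕ}
    (e : Fin k → Fin n) {K : Set (Cn n)} (hK : IsCompact K) (hKV : K ⊆ V) :
    ∃ C : ℝ, 0 ≤ C ∧ ∀ v, IsSmoothPSH V M v → ∫ p in K, traceAdj e v p ≤ C := by
  cases k with
  | zero => exact ⟨0, le_rfl, fun v _ => by simp [traceAdj]⟩
  | succ k =>
    choose C hC0 hC using fun i : Fin (k + 1) =>
      exists_integral_det_subHessian_le hV M k (e ∘ i.succAbove) K hK hKV
    refine ⟨∑ i, C i, Finset.sum_nonneg fun i _ => hC0 i, fun v hv => ?_⟩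
    simp only [traceAdj_succ]
    rw [integral_finsetSum]
    · exact Finset.sum_le_sum fun i _ => hC i v hv
    · intro i _
      exact (Complex.continuous_re.comp (continuous_det_subHessian _ hv.contDiff)).continuousOn
        |>.integrableOn_compact hK

/-- Jacobi's formula along a line of matrices. -/
theorem hasDerivAt_det_add_smul {k : ℕ} (B C : Matrix (Fin k) (Fin k) ℂ) (t : ℝ) :
    HasDerivAt (fun s : ℝ => (B + (s : ℂ) • C).det)
      (∑ j, ∑ l, (B + (t : ℂ) • C).adjugate l j * C j l) t := by
  -- The determinant along the line is a polynomial in the parameter, so differentiation becomes a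
  -- derivation of the polynomial ring and the column-by-column rule applies before evaluating.
  set M : Matrix (Fin k) (Fin k) (Polynomial ℂ) :=
    Matrix.of fun i j => Polynomial.C (B i j) + Polynomial.X * Polynomial.C (C i j) with hM
  have hev : ∀ s : ℂ, (Polynomial.evalRingHom s).mapMatrix M = B + s • C := fun s => by
    ext i j
    simp [hM]
    ring
  have hdet : ∀ s : ℂ, M.det.eval s = (B + s • C).det := fun s => by
    rw [← hev s, ← RingHom.map_det]; rfl
  have hder : Polynomial.derivative M.det =
      ∑ j, ∑ l, M.adjugate l j * Polynomial.C (C j l) := by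
    have hMd : ∀ j l, Polynomial.derivative (M j l) = Polynomial.C (C j l) := fun j l => by
      simp [hM]
    have h1 : Polynomial.derivative M.det =
        ∑ l, (M.updateCol l fun i => Polynomial.C (C i l)).det :=
      (Derivation.map_det (Polynomial.derivative' (R := ℂ)) M).trans
        (Finset.sum_congr rfl fun l _ => congrArg (fun c => (M.updateCol l c).det)
          (funext fun i => hMd i l))
    rw [h1, Finset.sum_comm]
    refine Finset.sum_congr rfl fun l _ => ?_
    rw [← Matrix.cramer_apply, Matrix.cramer_eq_adjugate_mulVec]
    simp only [Matrix.mulVec, dotProduct]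
  have hd := (Polynomial.hasDerivAt M.det (t : ℂ)).comp_ofReal
  simp only [hdet] at hd
  convert hd using 1
  rw [hder, Polynomial.eval_finsetSum]
  refine Finset.sum_congr rfl fun j _ => ?_
  rw [Polynomial.eval_finsetSum]
  refine Finset.sum_congr rfl fun l _ => ?_
  rw [Polynomial.eval_mul, Polynomial.eval_C, ← hev, ← RingHom.map_adjugate]
  rfl

end ChernLevineNirenberg

/-! ### Stability of the Monge-Ampère operator under uniform convergence -/

noncomputable section Stability

open scoped ComplexOrder

variable {n : ℕ}

/-- Convexity of the class makes the Chern-Levine-Nirenberg constant uniform along the segment from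
`w` to `v`. -/
theorem IsSmoothPSH.line {V : Set (Cn n)} {M : ℝ} {v w : Cn n → ℝ} (hv : IsSmoothPSH V M v)
    (hw : IsSmoothPSH V M w) {t : ℝ} (h0 : 0 ≤ t) (h1 : t ≤ 1) :
    IsSmoothPSH V M fun p => (1 - t) * w p + t * v p where
  contDiff := (contDiff_const.mul hw.contDiff).add (contDiff_const.mul hv.contDiff)
  posSemidef := fun p hp => by
    rw [complexHessian_add (contDiff_const.mul hw.contDiff) (contDiff_const.mul hv.contDiff),
      complexHessian_const_mul _ hw.contDiff, complexHessian_const_mul _ hv.contDiff]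
    exact ((hw.posSemidef p hp).smul (Complex.zero_le_real.2 (by linarith))).add
      ((hv.posSemidef p hp).smul (Complex.zero_le_real.2 h0))
  bound := fun p hp => by
    have h2 := abs_le.1 (hv.bound p hp)
    have h3 := abs_le.1 (hw.bound p hp)
    rw [abs_le]
    constructor <;> nlinarith

theorem complexHessian_line {v w : Cn n → ℝ} (hv : ContDiff ℝ ∞ v) (hw : ContDiff ℝ ∞ w)
    (t : ℝ) (p : Cn n) : complexHessian (fun p => (1 - t) * w p + t * v p) p =
      complexHessian w p + (t : ℂ) • complexHessian (fun p => v p - w p) p := by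
  have : (fun p => v p - w p) = fun p => v p + (-1) * w p := by funext p; ring
  rw [this, complexHessian_add (contDiff_const.mul hw) (contDiff_const.mul hv),
    complexHessian_add hv (contDiff_const.mul hw), complexHessian_const_mul _ hw,
    complexHessian_const_mul _ hv, complexHessian_const_mul _ hw]
  push_cast
  module

theorem hasDerivAt_integral_det_line {f : Cn n → ℝ} (hf : Continuous f)
    (hfc : HasCompactSupport f) {A B : Cn n → Matrix (Fin n) (Fin n) ℂ} (hA : Continuous A)
    (hB : Continuous B) (t : ℝ) :
    HasDerivAt (fun s : ℝ => ∫ p, (f p : ℂ) * (A p + (s : ℂ) • B p).det)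
      (∫ p, (f p : ℂ) * ∑ j, ∑ l, (A p + (t : ℂ) • B p).adjugate l j * B p j l) t := by
  have hcont : Continuous fun q : ℝ × Cn n => A q.2 + (q.1 : ℂ) • B q.2 :=
    (hA.comp continuous_snd).add
      ((Complex.continuous_ofReal.comp continuous_fst).smul (hB.comp continuous_snd))
  have hcF : Continuous fun q : ℝ × Cn n => (f q.2 : ℂ) * (A q.2 + (q.1 : ℂ) • B q.2).det :=
    (Complex.continuous_ofReal.comp (hf.comp continuous_snd)).mul hcont.matrix_det
  have hcF' : Continuous fun q : ℝ × Cn n => (f q.2 : ℂ) *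
      ∑ j, ∑ l, (A q.2 + (q.1 : ℂ) • B q.2).adjugate l j * B q.2 j l := by
    refine (Complex.continuous_ofReal.comp (hf.comp continuous_snd)).mul ?_
    refine continuous_finsetSum _ fun j _ => continuous_finsetSum _ fun l _ => ?_
    exact (hcont.matrix_adjugate.matrix_elem l j).mul
      ((hB.comp continuous_snd).matrix_elem j l)
  obtain ⟨b, hb⟩ := ((isCompact_Icc (a := t - 1) (b := t + 1)).prod
    hfc.isCompact).exists_bound_of_continuousOn hcF'.continuousOn
  have hslice : ∀ s : ℝ, Continuous fun p : Cn n => ((s, p) : ℝ × Cn n) := fun s => by fun_prop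
  have hcpt : HasCompactSupport fun p => (f p : ℂ) := hfc.comp_left Complex.ofReal_zero
  refine (hasDerivAt_integral_of_dominated_loc_of_deriv_le
    (bound := (tsupport f).indicator fun _ => b) (s := Icc (t - 1) (t + 1))
    (F := fun (s : ℝ) p => (f p : ℂ) * (A p + (s : ℂ) • B p).det)
    (F' := fun (s : ℝ) p => (f p : ℂ) *
      ∑ j, ∑ l, (A p + (s : ℂ) • B p).adjugate l j * B p j l)
    (Icc_mem_nhds (by linarith) (by linarith)) ?_ ?_ ?_ ?_ ?_ ?_).2
  · exact Eventually.of_forall fun s => (hcF.comp (hslice s)).aestronglyMeasurable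
  · exact (hcF.comp (hslice t)).integrable_of_hasCompactSupport hcpt.mul_right
  · exact (hcF'.comp (hslice t)).aestronglyMeasurable
  · refine Eventually.of_forall fun p s hs => ?_
    by_cases hp : p ∈ tsupport f
    · rw [indicator_of_mem hp]
      exact hb (s, p) ⟨hs, hp⟩
    · simp [image_eq_zero_of_notMem_tsupport hp, hp]
  · exact (integrable_indicator_iff (isClosed_tsupport f).measurableSet).2
      (integrableOn_const hfc.isCompact.measure_lt_top.ne)
  · exact Eventually.of_forall fun p s _ => (hasDerivAt_det_add_smul (A p) (B p) s).const_mul _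

theorem continuous_mongeAmpereDensity {v : Cn n → ℝ} (hv : ContDiff ℝ ∞ v) :
    Continuous (mongeAmpereDensity v) :=
  continuous_const.mul (Complex.continuous_re.comp (continuous_complexHessian hv).matrix_det)

theorem integrable_mul_mongeAmpereDensity {f v : Cn n → ℝ} (hf : Continuous f)
    (hfc : HasCompactSupport f) (hv : ContDiff ℝ ∞ v) :
    Integrable fun p => f p * mongeAmpereDensity v p :=
  (hf.mul (continuous_mongeAmpereDensity hv)).integrable_of_hasCompactSupport hfc.mul_right

theorem integral_mul_mongeAmpereDensity_eq {f v : Cn n → ℝ} (hf : Continuous f)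
    (hfc : HasCompactSupport f) (hv : ContDiff ℝ ∞ v) :
    ∫ p, f p * mongeAmpereDensity v p =
      (4 : ℝ) ^ n * (n.factorial : ℝ) * (∫ p, (f p : ℂ) * (complexHessian v p).det).re := by
  have hcpt : HasCompactSupport fun p => (f p : ℂ) := hfc.comp_left Complex.ofReal_zero
  have hint : Integrable fun p => (f p : ℂ) * (complexHessian v p).det :=
    ((Complex.continuous_ofReal.comp hf).mul
      (continuous_complexHessian hv).matrix_det).integrable_of_hasCompactSupport hcpt.mul_right
  have h1 : (∫ p, (f p : ℂ) * (complexHessian v p).det).re =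
      ∫ p, ((f p : ℂ) * (complexHessian v p).det).re := (integral_re hint).symm
  rw [h1, ← integral_const_mul]
  refine integral_congr_ae (Eventually.of_forall fun p => ?_)
  simp only [mongeAmpereDensity, Complex.re_ofReal_mul]
  ring

/-- Lipschitz stability of the Monge-Ampère operator tested against a smooth function. -/
theorem exists_abs_integral_sub_le {V : Set (Cn n)} (hV : IsOpen V) (M : ℝ) {f : Cn n → ℝ}
    (hf : ContDiff ℝ ∞ f) (hfc : HasCompactSupport f) (hfV : tsupport f ⊆ V) :
    ∃ C : ℝ, 0 ≤ C ∧ ∀ v w m, IsSmoothPSH V M v → IsSmoothPSH V M w → 0 ≤ m →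
      (∀ p ∈ V, |v p - w p| ≤ m) →
      |(∫ p, f p * mongeAmpereDensity v p) - ∫ p, f p * mongeAmpereDensity w p| ≤ C * m := by
  obtain ⟨b, hb0, hb⟩ := exists_bound_subHessian hf hfc
  obtain ⟨C, hC0, hC⟩ := exists_integral_traceAdj_le hV M (id : Fin n → Fin n) hfc.isCompact hfV
  refine ⟨(4 : ℝ) ^ n * (n.factorial : ℝ) * ((n : ℝ) ^ 2 * b * C), by positivity,
    fun v w m hv hw hm hvw => ?_⟩
  set g : ℝ → ℂ := fun s => ∫ p, (f p : ℂ) *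
    (complexHessian w p + (s : ℂ) • complexHessian (fun p => v p - w p) p).det with hg
  have hvwc : ContDiff ℝ ∞ fun p => v p - w p := hv.contDiff.sub hw.contDiff
  have hder := fun t => hasDerivAt_integral_det_line hf.continuous hfc
    (continuous_complexHessian hw.contDiff) (continuous_complexHessian hvwc) t
  -- Mean value inequality: the derivative of `g` pairs the adjugate of the Hessian on the segment
  -- with the Hessian of `v - w`; after integration by parts only `|v - w| ≤ m` enters.
  have hbound : ‖g 1 - g 0‖ ≤ m * ((n : ℝ) ^ 2 * b) * C := by
    refine norm_image_sub_le_of_norm_deriv_le_segment_01'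
      (fun t _ => (hder t).hasDerivWithinAt) fun t ht => ?_
    have hline := hv.line hw ht.1 ht.2.le
    have := norm_integral_adjugate_le (id : Fin n → Fin n) hline hvwc hvw hf hfc hfV hb
    simp only [subHessian, Matrix.submatrix_id_id, complexHessian_line hv.contDiff hw.contDiff]
      at this
    exact this.trans (mul_le_mul_of_nonneg_left (hC _ hline) (by positivity))
  have hg1 : g 1 = ∫ p, (f p : ℂ) * (complexHessian v p).det := by
    simp only [hg, ← complexHessian_line hv.contDiff hw.contDiff]
    simp
  have hg0 : g 0 = ∫ p, (f p : ℂ) * (complexHessian w p).det := by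
    simp [hg]
  have hc0 : (0 : ℝ) ≤ 4 ^ n * (n.factorial : ℝ) := by positivity
  rw [integral_mul_mongeAmpereDensity_eq hf.continuous hfc hv.contDiff,
    integral_mul_mongeAmpereDensity_eq hf.continuous hfc hw.contDiff, ← hg1, ← hg0, ← mul_sub,
    abs_mul, abs_of_nonneg hc0, ← Complex.sub_re,
    mul_assoc _ _ m]
  refine mul_le_mul_of_nonneg_left ?_ hc0
  calc |(g 1 - g 0).re| ≤ ‖g 1 - g 0‖ := Complex.abs_re_le_norm _
    _ ≤ m * ((n : ℝ) ^ 2 * b) * C := hbound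
    _ = _ := by ring

theorem mongeAmpereDensity_nonneg {v : Cn n → ℝ} {p : Cn n}
    (h : (complexHessian v p).PosSemidef) : 0 ≤ mongeAmpereDensity v p :=
  mul_nonneg (by positivity) h.det_re_nonneg

theorem exists_integral_mongeAmpereDensity_le {V : Set (Cn n)} (hV : IsOpen V) (M : ℝ)
    {K : Set (Cn n)} (hK : IsCompact K) (hKV : K ⊆ V) :
    ∃ C : ℝ, 0 ≤ C ∧ ∀ v, IsSmoothPSH V M v → ∫ p in K, mongeAmpereDensity v p ≤ C := by
  obtain ⟨C, hC0, hC⟩ := exists_integral_det_subHessian_le hV M n id K hK hKV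
  refine ⟨(4 : ℝ) ^ n * (n.factorial : ℝ) * C, by positivity, fun v hv => ?_⟩
  simp only [mongeAmpereDensity]
  rw [integral_const_mul]
  exact mul_le_mul_of_nonneg_left (hC v hv) (by positivity)

theorem abs_integral_mul_mongeAmpereDensity_le {V K : Set (Cn n)} {M η : ℝ} {f v : Cn n → ℝ}
    (hK : IsCompact K) (hKV : K ⊆ V) (hf : ∀ p, |f p| ≤ η) (hfK : ∀ p ∉ K, f p = 0)
    (hv : IsSmoothPSH V M v) :
    |∫ p, f p * mongeAmpereDensity v p| ≤ η * ∫ p in K, mongeAmpereDensity v p := by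
  rw [← setIntegral_eq_integral_of_forall_compl_eq_zero (s := K)
    (fun p hp => by rw [hfK p hp, zero_mul]), ← integral_const_mul, ← Real.norm_eq_abs]
  refine norm_integral_le_of_norm_le
    (((continuous_mongeAmpereDensity hv.contDiff).continuousOn.integrableOn_compact hK).const_mul _)
    ((ae_restrict_iff' hK.measurableSet).2 (Eventually.of_forall fun p hp => ?_))
  have h0 := mongeAmpereDensity_nonneg (hv.posSemidef p (hKV hp))
  rw [norm_mul, Real.norm_of_nonneg h0]
  exact mul_le_mul_of_nonneg_right (hf p) h0

/-- Stability of the Monge-Ampère operator under uniform convergence. -/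
theorem exists_forall_abs_integral_sub_le {V : Set (Cn n)} (hV : IsOpen V) (M : ℝ) {f : Cn n → ℝ}
    (hf : Continuous f) (hfc : HasCompactSupport f) (hfV : tsupport f ⊆ V) {ε : ℝ} (hε : 0 < ε) :
    ∃ δ : ℝ, 0 < δ ∧ ∀ v w, IsSmoothPSH V M v → IsSmoothPSH V M w →
      (∀ p ∈ V, |v p - w p| ≤ δ) →
      |(∫ p, f p * mongeAmpereDensity v p) - ∫ p, f p * mongeAmpereDensity w p| ≤ ε := by
  obtain ⟨C, hC0, hC⟩ := exists_integral_mongeAmpereDensity_le hV M hfc.isCompact hfV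
  -- Replacing `f` by a smooth `g` within `η` costs at most `η (C + 1) = ε / 4` for each of the two
  -- functions, leaving `ε / 2` for the smooth estimate. The `+ 1` keeps the denominators positive.
  set η : ℝ := ε / (4 * (C + 1)) with hη
  have hη0 : 0 < η := by positivity
  obtain ⟨g, hg, hfg, hsupp⟩ := hf.exists_contDiff_approx ⊤ (ε := fun _ => η) continuous_const
    fun _ => hη0
  have htg : tsupport g ⊆ tsupport f := closure_mono hsupp
  have hgc : HasCompactSupport g := hfc.mono hsupp
  obtain ⟨C', hC'0, hC'⟩ := exists_abs_integral_sub_le hV M hg hgc (htg.trans hfV)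
  refine ⟨ε / (2 * (C' + 1)), by positivity, fun v w hv hw hvw => ?_⟩
  have happ : ∀ u, IsSmoothPSH V M u →
      |(∫ p, f p * mongeAmpereDensity u p) - ∫ p, g p * mongeAmpereDensity u p| ≤ ε / 4 := by
    intro u hu
    rw [← integral_sub (integrable_mul_mongeAmpereDensity hf hfc hu.contDiff)
      (integrable_mul_mongeAmpereDensity hg.continuous hgc hu.contDiff)]
    simp only [← sub_mul]
    refine (abs_integral_mul_mongeAmpereDensity_le (η := η) hfc.isCompact hfV (fun p => ?_)
      (fun p hp => ?_) hu).trans ?_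
    · rw [abs_sub_comm]; exact (hfg p).le
    · rw [image_eq_zero_of_notMem_tsupport hp,
        image_eq_zero_of_notMem_tsupport fun h => hp (htg h), sub_zero]
    · calc η * ∫ p in tsupport f, mongeAmpereDensity u p ≤ η * (C + 1) :=
          mul_le_mul_of_nonneg_left ((hC u hu).trans (by linarith)) hη0.le
        _ = ε / 4 := by rw [hη]; field_simp
  have hsm := hC' v w _ hv hw (by positivity) hvw
  have h3 : C' * (ε / (2 * (C' + 1))) ≤ ε / 2 := by
    rw [mul_div_assoc', div_le_div_iff₀ (by positivity) (by positivity)]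
    nlinarith
  have h1 := abs_le.1 (happ v hv)
  have h2 := abs_le.1 (happ w hw)
  have h4 := abs_le.1 (hsm.trans h3)
  rw [abs_le]
  constructor <;> linarith [h1.1, h1.2, h2.1, h2.2, h4.1, h4.2]

end Stability

/-! ### Second derivatives of smooth plurisubharmonic functions along complex lines -/

noncomputable section SecondDerivatives

open scoped ComplexOrder

section Taylor

variable {E : Type*} [NormedAddCommGroup E] [NormedSpace ℝ E]

/-- Second order Taylor expansion of a twice continuously differentiable function. -/
theorem ContDiff.eventually_abs_taylor_two_le {u : E → ℝ} (hu : ContDiff ℝ ∞ u) (p : E) {ε : ℝ}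
    (hε : 0 < ε) : ∃ δ : ℝ, 0 < δ ∧ ∀ h : E, ‖h‖ < δ →
      |u (p + h) - u p - fderiv ℝ u p h - 1 / 2 * fderiv ℝ (fderiv ℝ u) p h h| ≤ ε * ‖h‖ ^ 2 := by
  have hd2 : HasFDerivAt (fderiv ℝ u) (fderiv ℝ (fderiv ℝ u) p) p :=
    ((hu.fderiv_right (m := ∞) (by simp)).contDiffAt.differentiableAt (by simp)).hasFDerivAt
  have hsymm : ∀ v w, fderiv ℝ (fderiv ℝ u) p v w = fderiv ℝ (fderiv ℝ u) p w v := fun v w =>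
    (hu.contDiffAt.isSymmSndFDerivAt two_le_infty).eq v w
  set B := fderiv ℝ (fderiv ℝ u) p with hB
  have hlittle := (hasFDerivAt_iff_isLittleO_nhds_zero.1 hd2).def hε
  obtain ⟨δ, hδ, hball⟩ := Metric.eventually_nhds_iff.1 hlittle
  refine ⟨δ, hδ, fun h hh => ?_⟩
  -- By symmetry of `B` the remainder has derivative `u'(p + x) - u'(p) - B x`, which is at most `ε
  -- ‖x‖` for small `x`; the mean value inequality gives the second-order bound.
  set R : E → ℝ := fun x => u (p + x) - u p - fderiv ℝ u p x - 1 / 2 * B x x with hR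
  have hder : ∀ x, HasFDerivAt R (fderiv ℝ u (p + x) - fderiv ℝ u p - B x) x := fun x => by
    have h1 : HasFDerivAt (fun x => u (p + x)) (fderiv ℝ u (p + x)) x := by
      have := (hu.contDiffAt.differentiableAt (by simp) : DifferentiableAt ℝ u (p + x)).hasFDerivAt
      exact (this.comp x ((hasFDerivAt_id x).const_add p))
    have h2 : HasFDerivAt (fun x => 1 / 2 * B x x) (B x) x := by
      have h3 := (B.hasFDerivAt (x := x)).clm_apply (hasFDerivAt_id x)
      have h4 := h3.const_mul (1 / 2 : ℝ)
      refine h4.congr_fderiv (ContinuousLinearMap.ext fun y => ?_)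
      have := hsymm y x
      simp only [id_eq, smul_apply, add_apply, ContinuousLinearMap.comp_apply,
        ContinuousLinearMap.flip_apply, smul_eq_mul, ContinuousLinearMap.id_apply, this]
      ring
    exact ((h1.sub_const _).sub (fderiv ℝ u p).hasFDerivAt).sub h2
  have hmv := (convex_closedBall (0 : E) ‖h‖).norm_image_sub_le_of_norm_hasFDerivWithin_le
    (f := R) (C := ε * ‖h‖) (x := 0) (y := h) (fun x _ => (hder x).hasFDerivWithinAt)
    (fun x hx => ?_) (by simp) (by simp)
  · have hR0 : R 0 = 0 := by simp [hR]
    rw [hR0, sub_zero, sub_zero, Real.norm_eq_abs] at hmv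
    refine hmv.trans (le_of_eq (by ring))
  · rw [mem_closedBall_zero_iff] at hx
    have := hball (y := x) (by simpa using hx.trans_lt hh)
    exact this.trans (mul_le_mul_of_nonneg_left hx hε.le)

end Taylor

variable {n : ℕ}

theorem circleAverage_four {f g h k : ℂ → ℝ} (hf : CircleIntegrable f 0 1)
    (hg : CircleIntegrable g 0 1) (hh : CircleIntegrable h 0 1) (hk : CircleIntegrable k 0 1) :
    Real.circleAverage ((f + g) + (h + k)) 0 1 =
      (Real.circleAverage f 0 1 + Real.circleAverage g 0 1) +
        (Real.circleAverage h 0 1 + Real.circleAverage k 0 1) := by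
  rw [Real.circleAverage_add (hf.add hg) (hh.add hk), Real.circleAverage_add hf hg,
    Real.circleAverage_add hh hk]

/-- The sum of second derivatives of a smooth plurisubharmonic function over a complex line. -/
theorem IsPSH.secondDeriv_nonneg {V : Set (Cn n)} (hV : IsOpen V) {u : Cn n → ℝ}
    (hu : ContDiff ℝ ∞ u) (hpsh : IsPSH V u) {p : Cn n} (hp : p ∈ V) (b : Cn n) :
    0 ≤ fderiv ℝ (fderiv ℝ u) p b b +
      fderiv ℝ (fderiv ℝ u) p (Complex.I • b) (Complex.I • b) := by
  have hsymm : ∀ v w, fderiv ℝ (fderiv ℝ u) p v w = fderiv ℝ (fderiv ℝ u) p w v := fun v w =>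
    (hu.contDiffAt.isSymmSndFDerivAt two_le_infty).eq v w
  set B := fderiv ℝ (fderiv ℝ u) p with hB
  set Q := B b b + B (Complex.I • b) (Complex.I • b) with hQ
  -- The sum over two directions differing by the factor `i` is the trace of `B` on the complex line
  -- and so is independent of the argument of `ζ`.
  have hrot : ∀ ζ : ℂ, B (ζ • b) (ζ • b) + B ((Complex.I * ζ) • b) ((Complex.I * ζ) • b) =
      ‖ζ‖ ^ 2 * Q := fun ζ => by
    have h1 : ζ • b = ζ.re • b + ζ.im • (Complex.I • b) := by
      conv_lhs => rw [← Complex.re_add_im ζ]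
      rw [add_smul, mul_smul, Complex.coe_smul, Complex.coe_smul]
    have h2 : (Complex.I * ζ) • b = (-ζ.im) • b + ζ.re • (Complex.I • b) := by
      have : Complex.I * ζ = ((-ζ.im : ℝ) : ℂ) + (ζ.re : ℂ) * Complex.I := by
        conv_lhs => rw [← Complex.re_add_im ζ]
        push_cast
        linear_combination (ζ.im : ℂ) * Complex.I_mul_I
      rw [this, add_smul, mul_smul, Complex.coe_smul, Complex.coe_smul]
    rw [h1, h2, ← Complex.normSq_eq_norm_sq, Complex.normSq_apply]
    simp only [map_add, map_smul, add_apply, smul_apply,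
      smul_eq_mul, hQ]
    rw [hsymm (Complex.I • b) b]
    ring
  by_contra hneg
  push Not at hneg
  -- Chosen so that the four Taylor errors satisfy `4 ε ‖b‖² ≤ -Q / 2` and cannot compensate a
  -- negative `Q`.
  set ε : ℝ := -Q / (8 * (‖b‖ ^ 2 + 1)) with hε
  have hε0 : 0 < ε := by
    have : 0 < -Q := by linarith
    positivity
  obtain ⟨δ, hδ, htay⟩ := hu.eventually_abs_taylor_two_le p hε0
  obtain ⟨ρ, hρ, hρV⟩ := Metric.isOpen_iff.1 hV p hp
  set r : ℝ := min δ ρ / (2 * (‖b‖ + 1)) with hr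
  have hr0 : 0 < r := by have := lt_min hδ hρ; positivity
  have hrb : r * ‖b‖ < min δ ρ := by
    have hm := lt_min hδ hρ
    rw [hr, div_mul_eq_mul_div, div_lt_iff₀ (by positivity)]
    nlinarith [norm_nonneg b]
  have hnorm : ∀ c ζ : ℂ, ‖c‖ = 1 → ‖ζ‖ ≤ 1 → ‖ζ • (c * (r : ℂ)) • b‖ ≤ r * ‖b‖ := by
    intro c ζ hc hζ
    rw [norm_smul, norm_smul, norm_mul, hc, Complex.norm_real, Real.norm_of_nonneg hr0.le, one_mul]
    exact mul_le_of_le_one_left (by positivity) hζ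
  have hsub : ∀ c : ℂ, ‖c‖ = 1 →
      CircleIntegrable (fun ζ : ℂ => u (p + ζ • (c * (r : ℂ)) • b)) 0 1 ∧
      u p ≤ Real.circleAverage (fun ζ : ℂ => u (p + ζ • (c * (r : ℂ)) • b)) 0 1 := fun c hc => by
    refine hpsh.subMean p ((c * (r : ℂ)) • b) fun ζ hζ => hρV ?_
    rw [Metric.mem_ball, dist_self_add_left]
    exact (hnorm c ζ hc hζ).trans_lt (hrb.trans_le (min_le_right _ _))
  -- The sub-mean inequality is added over the rotations `1, -1, i, -i` of one disc. Opposite signs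
  -- cancel the gradient and `hrot` makes the quadratic part constant, so the summed integrand is
  -- bounded pointwise and no integral of second derivatives is evaluated.
  obtain ⟨i1, s1⟩ := hsub 1 (by simp)
  obtain ⟨i2, s2⟩ := hsub (-1) (by simp)
  obtain ⟨i3, s3⟩ := hsub Complex.I (by simp)
  obtain ⟨i4, s4⟩ := hsub (-Complex.I) (by simp)
  have hsum := circleAverage_four i1 i2 i3 i4
  have hpt : ∀ ζ ∈ Metric.sphere (0 : ℂ) |1|, ((u (p + ζ • ((1 : ℂ) * (r : ℂ)) • b) +
      u (p + ζ • ((-1 : ℂ) * (r : ℂ)) • b)) + (u (p + ζ • (Complex.I * (r : ℂ)) • b) +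
      u (p + ζ • (-Complex.I * (r : ℂ)) • b))) ≤ 4 * u p + r ^ 2 * (Q + 4 * ε * ‖b‖ ^ 2) := by
    intro ζ hζ
    have hζ1 : ‖ζ‖ = 1 := by simpa using hζ
    set c : ℂ := ζ * r with hc
    have e1 : ζ • ((1 : ℂ) * (r : ℂ)) • b = c • b := by rw [smul_smul, hc]; ring_nf
    have e2 : ζ • ((-1 : ℂ) * (r : ℂ)) • b = -(c • b) := by
      rw [smul_smul, hc, ← neg_smul]; ring_nf
    have e3 : ζ • (Complex.I * (r : ℂ)) • b = (Complex.I * c) • b := by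
      rw [smul_smul, hc]; ring_nf
    have e4 : ζ • (-Complex.I * (r : ℂ)) • b = -((Complex.I * c) • b) := by
      rw [smul_smul, hc, ← neg_smul]; ring_nf
    rw [e1, e2, e3, e4]
    have hcn : ‖c‖ = r := by
      rw [hc, norm_mul, hζ1, Complex.norm_real, Real.norm_of_nonneg hr0.le, one_mul]
    have n1 : ‖c • b‖ = r * ‖b‖ := by rw [norm_smul, hcn]
    have n3 : ‖(Complex.I * c) • b‖ = r * ‖b‖ := by
      rw [norm_smul, norm_mul, hcn, Complex.norm_I, one_mul]
    have hlt := hrb.trans_le (min_le_left _ _)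
    have t1 := (abs_le.1 (htay (c • b) (by rw [n1]; exact hlt))).2
    have t2 := (abs_le.1 (htay (-(c • b)) (by rw [norm_neg, n1]; exact hlt))).2
    have t3 := (abs_le.1 (htay ((Complex.I * c) • b) (by rw [n3]; exact hlt))).2
    have t4 := (abs_le.1 (htay (-((Complex.I * c) • b)) (by rw [norm_neg, n3]; exact hlt))).2
    have hq := hrot c
    rw [hcn] at hq
    simp only [norm_neg, n1, n3, map_neg, neg_apply, neg_neg] at t1 t2 t3 t4
    nlinarith [t1, t2, t3, t4, hq]
  have havg := Real.circleAverage_mono_on_of_le_circle ((i1.add i2).add (i3.add i4)) hpt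
  have hfin : 0 ≤ r ^ 2 * (Q + 4 * ε * ‖b‖ ^ 2) := by
    have : 4 * u p ≤ 4 * u p + r ^ 2 * (Q + 4 * ε * ‖b‖ ^ 2) := by
      refine le_trans ?_ havg
      have h5 : (4 : ℝ) * u p = (u p + u p) + (u p + u p) := by ring
      rw [h5]
      refine le_trans (add_le_add (add_le_add s1 s2) (add_le_add s3 s4)) (le_of_eq hsum.symm)
    linarith
  have h6 : 0 ≤ Q + 4 * ε * ‖b‖ ^ 2 := nonneg_of_mul_nonneg_right hfin (by positivity)
  have h7 : 4 * ε * ‖b‖ ^ 2 ≤ -Q / 2 := by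
    rw [hε, mul_div_assoc', div_mul_eq_mul_div, div_le_div_iff₀ (by positivity) (by norm_num)]
    nlinarith [sq_nonneg ‖b‖]
  linarith

end SecondDerivatives

/-! ### The Levi form and positivity of the complex Hessian -/

noncomputable section LeviForm

open scoped ComplexOrder

variable {n : ℕ}

theorem dirDeriv_dirDeriv_smoothOfReal {u : Cn n → ℝ} (hu : ContDiff ℝ ∞ u) (v w p : Cn n) :
    (dirDeriv v (dirDeriv w (smoothOfReal u hu)) : Cn n → ℂ) p =
      ((fderiv ℝ (fderiv ℝ u) p v w : ℝ) : ℂ) := by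
  have h1 : ∀ q, HasFDerivAt (fun z => (u z : ℂ)) (Complex.ofRealCLM.comp (fderiv ℝ u q)) q :=
    fun q => Complex.ofRealCLM.hasFDerivAt.comp q
      (hu.contDiffAt.differentiableAt (by simp) : DifferentiableAt ℝ u q).hasFDerivAt
  have h2 : (dirDeriv w (smoothOfReal u hu) : Cn n → ℂ) =
      fun q => ((fderiv ℝ u q w : ℝ) : ℂ) := by
    funext q
    rw [dirDeriv_apply]
    change fderiv ℝ (fun z => (u z : ℂ)) q w = _
    rw [(h1 q).fderiv]
    rfl
  have hd2 : HasFDerivAt (fderiv ℝ u) (fderiv ℝ (fderiv ℝ u) p) p :=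
    ((hu.fderiv_right (m := ∞) (by simp)).contDiffAt.differentiableAt (by simp)).hasFDerivAt
  have h3 : HasFDerivAt (fun q => ((fderiv ℝ u q w : ℝ) : ℂ))
      (Complex.ofRealCLM.comp ((fderiv ℝ (fderiv ℝ u) p).flip w)) p := by
    have h4 := Complex.ofRealCLM.hasFDerivAt.comp p (hd2.clm_apply (hasFDerivAt_const w p))
    refine h4.congr_fderiv (ContinuousLinearMap.ext fun y => ?_)
    simp
  rw [dirDeriv_apply, h2, h3.fderiv]
  rfl

/-- The sesquilinear form associated with a real bilinear form on `ℂⁿ`. -/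
def leviForm (B : Cn n →L[ℝ] Cn n →L[ℝ] ℝ) : Cn n →ₗ[ℂ] Cn n →ₛₗ[starRingEnd ℂ] ℂ :=
  LinearMap.mk₂'ₛₗ (RingHom.id ℂ) (starRingEnd ℂ)
    (fun v w => (1 / 4 : ℂ) * (((B v w : ℝ) : ℂ) + Complex.I * ((B v (Complex.I • w) : ℝ) : ℂ) -
      Complex.I * ((B (Complex.I • v) w : ℝ) : ℂ) +
        ((B (Complex.I • v) (Complex.I • w) : ℝ) : ℂ)))
    (fun v₁ v₂ w => by
      simp only [smul_add, map_add, add_apply]; push_cast; ring)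
    (fun c v w => by
      have h1 : c • v = c.re • v + c.im • (Complex.I • v) := by
        conv_lhs => rw [← Complex.re_add_im c]
        rw [add_smul, mul_smul, Complex.coe_smul, Complex.coe_smul]
      have h2 : Complex.I • c • v = (-c.im) • v + c.re • (Complex.I • v) := by
        have : Complex.I * c = ((-c.im : ℝ) : ℂ) + (c.re : ℂ) * Complex.I := by
          conv_lhs => rw [← Complex.re_add_im c]
          push_cast
          linear_combination (c.im : ℂ) * Complex.I_mul_I
        rw [smul_smul, this, add_smul, mul_smul, Complex.coe_smul, Complex.coe_smul]
      rw [h2, h1]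
      conv_rhs => rw [RingHom.id_apply, ← Complex.re_add_im c]
      simp only [map_add, map_smul, add_apply, smul_apply, smul_eq_mul]
      push_cast
      ring_nf
      simp only [Complex.I_sq]
      ring)
    (fun v w₁ w₂ => by
      simp only [smul_add, map_add]; push_cast; ring)
    (fun c v w => by
      have h1 : c • w = c.re • w + c.im • (Complex.I • w) := by
        conv_lhs => rw [← Complex.re_add_im c]
        rw [add_smul, mul_smul, Complex.coe_smul, Complex.coe_smul]
      have h2 : Complex.I • c • w = (-c.im) • w + c.re • (Complex.I • w) := by
        have : Complex.I * c = ((-c.im : ℝ) : ℂ) + (c.re : ℂ) * Complex.I := by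
          conv_lhs => rw [← Complex.re_add_im c]
          push_cast
          linear_combination (c.im : ℂ) * Complex.I_mul_I
        rw [smul_smul, this, add_smul, mul_smul, Complex.coe_smul, Complex.coe_smul]
      rw [h2, h1]
      have h3 : (starRingEnd ℂ) c = (c.re : ℂ) - (c.im : ℂ) * Complex.I := by
        apply Complex.ext <;> simp
      rw [h3]
      simp only [map_add, map_smul, smul_eq_mul]
      push_cast
      ring_nf
      simp only [Complex.I_sq]
      ring)

theorem leviForm_apply (B : Cn n →L[ℝ] Cn n →L[ℝ] ℝ) (v w : Cn n) : leviForm B v w =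
    (1 / 4 : ℂ) * (((B v w : ℝ) : ℂ) + Complex.I * ((B v (Complex.I • w) : ℝ) : ℂ) -
      Complex.I * ((B (Complex.I • v) w : ℝ) : ℂ) +
        ((B (Complex.I • v) (Complex.I • w) : ℝ) : ℂ)) := rfl

/-- With the entries written as values of one sesquilinear form, the quadratic form of the matrix
becomes the value of that form at a single vector. -/
theorem complexHessian_eq_leviForm {u : Cn n → ℝ} (hu : ContDiff ℝ ∞ u) (p : Cn n)
    (j k : Fin n) :
    complexHessian u p j k = leviForm (fderiv ℝ (fderiv ℝ u) p) (stdVec j) (stdVec k) := by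
  have h1 : wirtDer j (wirtBarDer k (smoothOfReal u hu)) =
      (1 / 4 : ℂ) • (dirDeriv (stdVec j) (dirDeriv (stdVec k) (smoothOfReal u hu)) +
        Complex.I • dirDeriv (stdVec j) (dirDeriv (Complex.I • stdVec k) (smoothOfReal u hu)) -
        Complex.I • dirDeriv (Complex.I • stdVec j) (dirDeriv (stdVec k) (smoothOfReal u hu)) +
        dirDeriv (Complex.I • stdVec j) (dirDeriv (Complex.I • stdVec k) (smoothOfReal u hu))) := by
    simp only [wirtDer_apply, wirtBarDer_apply, Derivation.map_smul, Derivation.map_add]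
    have h : Complex.I * Complex.I = -1 := Complex.I_mul_I
    simp only [smul_add, smul_sub, smul_smul]
    match_scalars <;> first | ring1 | linear_combination (-1 / 4 : ℂ) * h
  rw [complexHessian_apply u hu, h1, leviForm_apply]
  simp only [← dirDeriv_dirDeriv_smoothOfReal hu]
  rfl

/-- The complex Hessian of a smooth plurisubharmonic function is positive semidefinite. -/
theorem IsPSH.posSemidef_complexHessian {V : Set (Cn n)} (hV : IsOpen V) {u : Cn n → ℝ}
    (hu : ContDiff ℝ ∞ u) (hpsh : IsPSH V u) {p : Cn n} (hp : p ∈ V) :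
    (complexHessian u p).PosSemidef := by
  have hsymm : ∀ v w, fderiv ℝ (fderiv ℝ u) p v w = fderiv ℝ (fderiv ℝ u) p w v := fun v w =>
    (hu.contDiffAt.isSymmSndFDerivAt two_le_infty).eq v w
  have hpos := hpsh.secondDeriv_nonneg hV hu hp
  rw [Matrix.posSemidef_iff_dotProduct_mulVec]
  have hH := complexHessian_eq_leviForm hu p
  set B := fderiv ℝ (fderiv ℝ u) p with hB
  constructor
  · ext j k
    rw [Matrix.conjTranspose_apply, hH, hH, leviForm_apply, leviForm_apply, hsymm (stdVec k),
      hsymm (stdVec k), hsymm (Complex.I • stdVec k), hsymm (Complex.I • stdVec k)]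
    apply Complex.ext <;> simp
    ring
  · intro x
    -- The coefficients are conjugated because `leviForm` is linear in its first argument, while
    -- `star x` stands on the left of the matrix.
    set b : Cn n := ∑ j, (starRingEnd ℂ) (x j) • stdVec j with hb
    have h1 : star x ⬝ᵥ (complexHessian u p).mulVec x = leviForm B b b := by
      simp only [hb, map_sum, LinearMap.sum_apply, LinearMap.map_smulₛₗ, LinearMap.smul_apply,
        RingHom.id_apply, Complex.conj_conj, smul_eq_mul, dotProduct, Matrix.mulVec, hH,
        Pi.star_apply, Complex.star_def, Finset.mul_sum]
      rw [Finset.sum_comm]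
      refine Finset.sum_congr rfl fun j _ => Finset.sum_congr rfl fun k _ => by ring
    rw [h1, leviForm_apply, hsymm (Complex.I • b) b]
    have h2 : (1 / 4 : ℂ) * (((B b b : ℝ) : ℂ) + Complex.I * ((B b (Complex.I • b) : ℝ) : ℂ) -
        Complex.I * ((B b (Complex.I • b) : ℝ) : ℂ) +
        ((B (Complex.I • b) (Complex.I • b) : ℝ) : ℂ)) =
        ((1 / 4 * (B b b + B (Complex.I • b) (Complex.I • b)) : ℝ) : ℂ) := by
      push_cast
      ring
    rw [h2]
    exact Complex.zero_le_real.2 (mul_nonneg (by norm_num) (hpos b))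

end LeviForm

/-! ### Mollification of continuous plurisubharmonic functions -/

noncomputable section Mollification

variable {n : ℕ}

/-- The standard bump functions with shrinking supports. -/
def stdBump (n i : ℕ) : ContDiffBump (0 : Cn n) where
  rIn := 1 / (2 * ((i : ℝ) + 1))
  rOut := 1 / ((i : ℝ) + 1)
  rIn_pos := by positivity
  rIn_lt_rOut := by
    apply one_div_lt_one_div_of_lt <;> nlinarith [(Nat.cast_nonneg i : (0 : ℝ) ≤ i)]

/-- The regularisations of a function on `ℂⁿ`. -/
def mollify (i : ℕ) (g : Cn n → ℝ) : Cn n → ℝ :=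
  convolution ((stdBump n i).normed volume) g (ContinuousLinearMap.lsmul ℝ ℝ) volume

theorem mollify_apply (i : ℕ) (g : Cn n → ℝ) (x : Cn n) :
    mollify i g x = ∫ t, (stdBump n i).normed volume t * g (x - t) := rfl

theorem integrable_stdBump (i : ℕ) : Integrable ((stdBump n i).normed (volume : Measure (Cn n))) :=
  (stdBump n i).integrable_normed

theorem integrable_mollify_integrand (i : ℕ) {g : Cn n → ℝ} (hg : Measurable g) {M : ℝ}
    (hM : ∀ x, |g x| ≤ M) (x : Cn n) :
    Integrable fun t => (stdBump n i).normed volume t * g (x - t) :=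
  (integrable_stdBump i).mul_bdd (c := M)
    (hg.comp (measurable_const.sub measurable_id)).aestronglyMeasurable
    (Eventually.of_forall fun _ => hM _)

theorem contDiff_mollify (i : ℕ) {g : Cn n → ℝ} (hg : Measurable g) {M : ℝ}
    (hM : ∀ x, |g x| ≤ M) : ContDiff ℝ ∞ (mollify i g) := by
  refine HasCompactSupport.contDiff_convolution_left (n := ⊤) _
    (stdBump n i).hasCompactSupport_normed (stdBump n i).contDiff_normed ?_
  rw [locallyIntegrable_iff]
  intro K hK
  exact Measure.integrableOn_of_bounded hK.measure_lt_top.ne hg.aestronglyMeasurable (M := M)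
    (Eventually.of_forall hM)

theorem abs_mollify_le (i : ℕ) {g : Cn n → ℝ} {M : ℝ}
    (hM : ∀ x, |g x| ≤ M) (x : Cn n) : |mollify i g x| ≤ M := by
  have h1 : ∫ t, (stdBump n i).normed volume t * M = M := by
    rw [integral_mul_const, (stdBump n i).integral_normed, one_mul]
  rw [mollify_apply, ← Real.norm_eq_abs]
  refine (norm_integral_le_of_norm_le ((integrable_stdBump i).mul_const M)
    (Eventually.of_forall fun t => ?_)).trans h1.le
  rw [norm_mul, Real.norm_of_nonneg ((stdBump n i).nonneg_normed t)]
  exact mul_le_mul_of_nonneg_left (hM _) ((stdBump n i).nonneg_normed t)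

theorem mollify_add (i : ℕ) {g h : Cn n → ℝ} (hg : Measurable g) (hh : Measurable h) {M M' : ℝ}
    (hM : ∀ x, |g x| ≤ M) (hM' : ∀ x, |h x| ≤ M') (x : Cn n) :
    mollify i (fun x => g x + h x) x = mollify i g x + mollify i h x := by
  simp only [mollify_apply, mul_add]
  exact integral_add (integrable_mollify_integrand i hg hM x)
    (integrable_mollify_integrand i hh hM' x)

theorem ContinuousOn.measurable_indicator {D : Set (Cn n)} (hD : IsOpen D) {u : Cn n → ℝ}
    (hu : ContinuousOn u D) : Measurable (D.indicator u) := by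
  classical
  rw [← Set.piecewise_eq_indicator]
  exact hu.measurable_piecewise continuousOn_const hD.measurableSet

theorem abs_indicator_le {D : Set (Cn n)} {u : Cn n → ℝ} {M : ℝ} (hM : 0 ≤ M)
    (hu : ∀ x ∈ D, |u x| ≤ M) (x : Cn n) : |D.indicator u x| ≤ M := by
  by_cases hx : x ∈ D
  · rw [indicator_of_mem hx]; exact hu x hx
  · rw [indicator_of_notMem hx]; simpa

/-- Mollifications converge uniformly on compact sets. -/
theorem eventually_abs_mollify_sub_le {D : Set (Cn n)} (hD : IsOpen D) {u : Cn n → ℝ}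
    (hu : ContinuousOn u D) {K : Set (Cn n)} (hK : IsCompact K) (hKD : K ⊆ D) {ε : ℝ}
    (hε : 0 < ε) :
    ∀ᶠ i in atTop, ∀ x ∈ K, |mollify i (D.indicator u) x - u x| ≤ ε := by
  obtain ⟨δ, hδ, hKδ⟩ := hK.exists_cthickening_subset_open hD hKD
  have huc := (hK.cthickening (r := δ)).uniformContinuousOn_of_continuous (hu.mono hKδ)
  obtain ⟨δ', hδ', huc'⟩ := Metric.uniformContinuousOn_iff_le.1 huc ε hε
  have hlim : Tendsto (fun i : ℕ => 1 / ((i : ℝ) + 1)) atTop (𝓝 0) :=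
    tendsto_one_div_add_atTop_nhds_zero_nat
  filter_upwards [hlim.eventually (gt_mem_nhds (lt_min hδ hδ'))] with i hi x hx
  have hxD := hKD hx
  have h := ContDiffBump.dist_normed_convolution_le (φ := stdBump n i) (x₀ := x) (ε := ε)
    (μ := (volume : Measure (Cn n)))
    (hu.measurable_indicator hD).aestronglyMeasurable fun y hy => ?_
  · rw [indicator_of_mem hxD] at h
    exact h
  · have hy' : dist y x < min δ δ' := lt_trans (Metric.mem_ball.1 hy) hi
    have hyK : y ∈ Metric.cthickening δ K :=
      Metric.mem_cthickening_of_dist_le y x δ K hx (hy'.le.trans (min_le_left _ _))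
    rw [indicator_of_mem hxD, indicator_of_mem (hKδ hyK)]
    exact huc' y hyK x (Metric.self_subset_cthickening K hx) (hy'.le.trans (min_le_right _ _))

/-- Mollification preserves plurisubharmonicity away from the boundary. -/
theorem IsPSH.mollify {D V : Set (Cn n)} (hD : IsOpen D) {u : Cn n → ℝ} (hu : ContinuousOn u D)
    (hpsh : IsPSH D u) {M : ℝ} (hM0 : 0 ≤ M) (hM : ∀ x ∈ D, |u x| ≤ M) {i : ℕ}
    (hV : ∀ x ∈ V, Metric.ball x (1 / ((i : ℝ) + 1)) ⊆ D) :
    IsPSH V (mollify i (D.indicator u)) := by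
  set g := D.indicator u with hg
  have hgm : Measurable g := hu.measurable_indicator hD
  have hgM : ∀ x, |g x| ≤ M := abs_indicator_le hM0 hM
  have hcont : Continuous (_root_.mollify i g) := (contDiff_mollify i hgm hgM).continuous
  refine ⟨hcont.upperSemicontinuous.upperSemicontinuousOn _, fun a b hab => ?_⟩
  have hcirc : Continuous fun ζ : ℂ => _root_.mollify i g (a + ζ • b) :=
    hcont.comp (continuous_const.add (continuous_id.smul continuous_const))
  refine ⟨hcirc.continuousOn.circleIntegrable zero_le_one, ?_⟩
  set φ := (stdBump n i).normed (volume : Measure (Cn n)) with hφ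
  have hφi : Integrable φ := integrable_stdBump i
  have hφ0 : ∀ t, 0 ≤ φ t := (stdBump n i).nonneg_normed
  have hpi : (0 : ℝ) ≤ 2 * Real.pi := by positivity
  have : IsFiniteMeasure ((volume : Measure ℝ).restrict (uIoc 0 (2 * Real.pi))) := by
    rw [uIoc_of_le hpi]
    infer_instance
  have hprod : Integrable
      (Function.uncurry fun (θ : ℝ) t => φ t * g (a + circleMap 0 1 θ • b - t))
      ((volume.restrict (uIoc 0 (2 * Real.pi))).prod volume) := by
    have hb : Integrable (fun q : ℝ × Cn n => φ q.2 * M)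
        ((volume.restrict (uIoc 0 (2 * Real.pi))).prod volume) :=
      Integrable.comp_snd (f := fun t => φ t * M) (hφi.mul_const M) _
    refine hb.mono' ?_ (Eventually.of_forall fun q => ?_)
    · have hφm : Measurable φ := (stdBump n i).continuous_normed.measurable
      refine Measurable.aestronglyMeasurable ?_
      refine (hφm.comp measurable_snd).mul (hgm.comp ?_)
      have : Continuous fun q : ℝ × Cn n => a + circleMap 0 1 q.1 • b - q.2 := by
        have := continuous_circleMap 0 1
        fun_prop
      exact this.measurable
    · simp only [Function.uncurry]
      rw [norm_mul, Real.norm_of_nonneg (hφ0 _)]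
      exact mul_le_mul_of_nonneg_left (hgM _) (hφ0 _)
  -- Fubini: the circle average of the mollification is the mollification of circle averages over
  -- translated discs. Where the kernel does not vanish, the translate still lies in `D` and the
  -- sub-mean inequality for `u` applies.
  have havg : Real.circleAverage (fun ζ : ℂ => _root_.mollify i g (a + ζ • b)) 0 1 =
      ∫ t, φ t * ((2 * Real.pi)⁻¹ * ∫ θ in (0)..(2 * Real.pi),
        g (a + circleMap 0 1 θ • b - t)) := by
    rw [Real.circleAverage_def, smul_eq_mul]
    simp only [mollify_apply]
    rw [intervalIntegral_integral_swap hprod, ← integral_const_mul]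
    refine integral_congr_ae (Eventually.of_forall fun t => ?_)
    simp only [intervalIntegral.integral_const_mul]
    ring
  rw [havg, mollify_apply]
  refine integral_mono ?_ ?_ fun t => ?_
  · exact integrable_mollify_integrand i hgm hgM a
  · have h1 := hprod.integral_prod_right
    refine (h1.const_mul (2 * Real.pi)⁻¹).congr (Eventually.of_forall fun t => ?_)
    simp only [Function.uncurry]
    rw [uIoc_of_le hpi, ← intervalIntegral.integral_of_le hpi]
    simp only [intervalIntegral.integral_const_mul]
    ring
  · by_cases ht : t ∈ Metric.ball (0 : Cn n) (1 / ((i : ℝ) + 1))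
    · refine mul_le_mul_of_nonneg_left ?_ (hφ0 t)
      have hdisc : ∀ ζ : ℂ, ‖ζ‖ ≤ 1 → (a - t) + ζ • b ∈ D := fun ζ hζ => by
        refine hV _ (hab ζ hζ) ?_
        rw [Metric.mem_ball, dist_eq_norm]
        have : a - t + ζ • b - (a + ζ • b) = -t := by abel
        rw [this, norm_neg]
        simpa using ht
      have hs := (hpsh.subMean (a - t) b hdisc).2
      have ha : a - t ∈ D := by simpa using hdisc 0 (by simp)
      rw [hg, indicator_of_mem ha]
      refine hs.trans (le_of_eq ?_)
      rw [Real.circleAverage_def, smul_eq_mul]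
      congr 1
      refine intervalIntegral.integral_congr fun θ _ => ?_
      have hmem := hdisc (circleMap 0 1 θ) (by simp)
      have he : a + circleMap 0 1 θ • b - t = a - t + circleMap 0 1 θ • b := by abel
      simp only [he, indicator_of_mem hmem]
    · have : φ t = 0 := by
        have h2 := (stdBump n i).support_normed_eq (μ := (volume : Measure (Cn n)))
        by_contra hne
        have h3 : t ∈ Function.support φ := hne
        rw [hφ, h2] at h3
        exact ht h3
      change φ t * _ ≤ _
      rw [this, zero_mul, zero_mul]

end Mollification

/-! ### Weak limits of Monge-Ampère masses -/

noncomputable section WeakLimits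

open scoped ComplexOrder

variable {n : ℕ}

theorem IsPSH.mono {D V : Set (Cn n)} {u : Cn n → ℝ} (h : IsPSH D u) (hVD : V ⊆ D) :
    IsPSH V u :=
  ⟨h.usc.mono hVD, fun a b hab => h.subMean a b fun ζ hζ => hVD (hab ζ hζ)⟩

theorem IsPSH.congr {D : Set (Cn n)} {u v : Cn n → ℝ} (h : IsPSH D u) (huv : EqOn u v D) :
    IsPSH D v := by
  refine ⟨fun x hx y hy => ?_, fun a b hab => ?_⟩
  · change v x < y at hy
    rw [← huv hx] at hy
    filter_upwards [h.usc x hx y hy, self_mem_nhdsWithin] with z hz hzD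
    change v z < y
    rw [← huv hzD]
    exact hz
  · obtain ⟨hi, hle⟩ := h.subMean a b hab
    have he : EqOn (fun ζ : ℂ => u (a + ζ • b)) (fun ζ : ℂ => v (a + ζ • b))
        (Metric.sphere 0 |1|) := fun ζ hζ =>
      huv (hab ζ (by simpa using (le_of_eq (by simpa using hζ))))
    have ha : a ∈ D := by simpa using hab 0 (by simp)
    rw [← huv ha, ← Real.circleAverage_congr_sphere he]
    exact ⟨IntervalIntegrable.congr (fun θ _ => he (by simp)) hi, hle⟩

theorem IsPSH.add_const {D : Set (Cn n)} {u : Cn n → ℝ} (h : IsPSH D u) (c : ℝ) :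
    IsPSH D fun z => u z + c := by
  refine ⟨h.usc.add upperSemicontinuousOn_const, fun a b hab => ?_⟩
  obtain ⟨hi, hle⟩ := h.subMean a b hab
  have hc : CircleIntegrable (fun _ : ℂ => c) 0 1 := circleIntegrable_const c 0 1
  refine ⟨hi.add hc, ?_⟩
  rw [Real.circleAverage_fun_add hi hc, Real.circleAverage_const]
  linarith

/-- A continuous plurisubharmonic function bounded by `M`. -/
structure IsContPSH (D : Set (Cn n)) (M : ℝ) (u : Cn n → ℝ) : Prop where
  continuousOn : ContinuousOn u D
  psh : IsPSH D u
  nonneg : 0 ≤ M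
  bound : ∀ x ∈ D, |u x| ≤ M

theorem IsContPSH.mono {D V : Set (Cn n)} {M : ℝ} {u : Cn n → ℝ} (h : IsContPSH D M u)
    (hVD : V ⊆ D) : IsContPSH V M u :=
  ⟨h.continuousOn.mono hVD, h.psh.mono hVD, h.nonneg, fun x hx => h.bound x (hVD hx)⟩

theorem IsSmoothPSH.mono_bound {V : Set (Cn n)} {M M' : ℝ} {u : Cn n → ℝ}
    (h : IsSmoothPSH V M u) (hM : M ≤ M') : IsSmoothPSH V M' u :=
  ⟨h.contDiff, h.posSemidef, fun p hp => (h.bound p hp).trans hM⟩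

theorem IsContPSH.contDiff_mollify {D : Set (Cn n)} (hD : IsOpen D) {M : ℝ} {u : Cn n → ℝ}
    (hu : IsContPSH D M u) (i : ℕ) : ContDiff ℝ ∞ (mollify i (D.indicator u)) :=
  _root_.contDiff_mollify i (hu.continuousOn.measurable_indicator hD)
    (abs_indicator_le hu.nonneg hu.bound)

theorem IsContPSH.eventually_isPSH_mollify {D V : Set (Cn n)} (hD : IsOpen D) {M : ℝ}
    {u : Cn n → ℝ} (hu : IsContPSH D M u) (hc : IsCompact (closure V)) (hVD : closure V ⊆ D) :
    ∀ᶠ i in atTop, IsPSH V (mollify i (D.indicator u)) := by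
  obtain ⟨δ, hδ, hKδ⟩ := hc.exists_cthickening_subset_open hD hVD
  have hlim : Tendsto (fun i : ℕ => 1 / ((i : ℝ) + 1)) atTop (𝓝 0) :=
    tendsto_one_div_add_atTop_nhds_zero_nat
  filter_upwards [hlim.eventually (gt_mem_nhds hδ)] with i hi
  refine hu.psh.mollify hD hu.continuousOn hu.nonneg hu.bound fun x hx y hy => hKδ ?_
  exact Metric.mem_cthickening_of_dist_le y x δ _ (subset_closure hx)
    ((Metric.mem_ball.1 hy).le.trans hi.le)

theorem IsContPSH.eventually_isSmoothPSH_mollify {D V : Set (Cn n)} (hD : IsOpen D) {M : ℝ}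
    {u : Cn n → ℝ} (hu : IsContPSH D M u) (hV : IsOpen V) (hc : IsCompact (closure V))
    (hVD : closure V ⊆ D) :
    ∀ᶠ i in atTop, IsSmoothPSH V M (mollify i (D.indicator u)) := by
  filter_upwards [hu.eventually_isPSH_mollify hD hc hVD] with i hi
  have hs := hu.contDiff_mollify hD i
  exact ⟨hs, fun p hp => hi.posSemidef_complexHessian hV hs hp,
    fun p _ => abs_mollify_le i (abs_indicator_le hu.nonneg hu.bound) p⟩

/-- The Monge-Ampère masses of uniformly close sequences have the same limits. -/
theorem tendsto_integral_mongeAmpereDensity_sub {V : Set (Cn n)} (hV : IsOpen V) {M : ℝ}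
    {u : Cn n → ℝ} {v w : ℕ → Cn n → ℝ} (hv : ∀ᶠ i in atTop, IsSmoothPSH V M (v i))
    (hw : ∀ᶠ i in atTop, IsSmoothPSH V M (w i))
    (hvu : ∀ ε > 0, ∀ᶠ i in atTop, ∀ x ∈ V, |v i x - u x| ≤ ε)
    (hwu : ∀ ε > 0, ∀ᶠ i in atTop, ∀ x ∈ V, |w i x - u x| ≤ ε) {f : Cn n → ℝ}
    (hf : Continuous f) (hfc : HasCompactSupport f) (hfV : tsupport f ⊆ V) :
    Tendsto (fun i => (∫ p, f p * mongeAmpereDensity (v i) p) -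
      ∫ p, f p * mongeAmpereDensity (w i) p) atTop (𝓝 0) := by
  rw [Metric.tendsto_atTop']
  intro ε hε
  obtain ⟨δ, hδ, hst⟩ := exists_forall_abs_integral_sub_le hV M hf hfc hfV (half_pos hε)
  obtain ⟨N, hN⟩ := eventually_atTop.1
    (((hv.and hw).and (hvu (δ / 2) (half_pos hδ))).and (hwu (δ / 2) (half_pos hδ)))
  refine ⟨N, fun i hi => ?_⟩
  obtain ⟨⟨⟨h1, h2⟩, h3⟩, h4⟩ := hN i hi.le
  rw [Real.dist_eq, sub_zero]
  refine lt_of_le_of_lt (hst _ _ h1 h2 fun p hp => ?_) (half_lt_self hε)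
  have := abs_sub_le (v i p) (u p) (w i p)
  have h5 := h4 p hp
  rw [abs_sub_comm] at h5
  linarith [h3 p hp]

theorem cauchySeq_integral_mongeAmpereDensity {V : Set (Cn n)} (hV : IsOpen V) {M : ℝ}
    {u : Cn n → ℝ} {v : ℕ → Cn n → ℝ} (hv : ∀ᶠ i in atTop, IsSmoothPSH V M (v i))
    (hvu : ∀ ε > 0, ∀ᶠ i in atTop, ∀ x ∈ V, |v i x - u x| ≤ ε) {f : Cn n → ℝ}
    (hf : Continuous f) (hfc : HasCompactSupport f) (hfV : tsupport f ⊆ V) :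
    CauchySeq fun i => ∫ p, f p * mongeAmpereDensity (v i) p := by
  rw [Metric.cauchySeq_iff]
  intro ε hε
  obtain ⟨δ, hδ, hst⟩ := exists_forall_abs_integral_sub_le hV M hf hfc hfV (half_pos hε)
  obtain ⟨N, hN⟩ := eventually_atTop.1 (hv.and (hvu (δ / 2) (half_pos hδ)))
  refine ⟨N, fun i hi j hj => ?_⟩
  rw [Real.dist_eq]
  refine lt_of_le_of_lt (hst _ _ (hN i hi).1 (hN j hj).1 fun p hp => ?_) (half_lt_self hε)
  have := abs_sub_le (v i p) (u p) (v j p)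
  have h5 := (hN j hj).2 p hp
  rw [abs_sub_comm] at h5
  linarith [(hN i hi).2 p hp]

/-- Mollifications converge uniformly near the support of `f`, so stability makes the masses Cauchy.
The limit is the prospective integral of `f` against the Monge-Ampère measure. -/
theorem IsContPSH.exists_tendsto {D : Set (Cn n)} (hD : IsOpen D) {M : ℝ} {u : Cn n → ℝ}
    (hu : IsContPSH D M u) {f : Cn n → ℝ} (hf : Continuous f) (hfc : HasCompactSupport f)
    (hfD : tsupport f ⊆ D) :
    ∃ L : ℝ, Tendsto (fun i => ∫ p, f p * mongeAmpereDensity (mollify i (D.indicator u)) p)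
      atTop (𝓝 L) := by
  obtain ⟨V, hV, hKV, hVD, hVc⟩ := exists_open_between_and_isCompact_closure hfc.isCompact hD hfD
  refine cauchySeq_tendsto_of_complete (cauchySeq_integral_mongeAmpereDensity hV (u := u)
    (hu.eventually_isSmoothPSH_mollify hD hV hVc hVD) (fun ε hε => ?_) hf hfc hKV)
  filter_upwards [eventually_abs_mollify_sub_le hD hu.continuousOn hVc hVD hε] with i hi x hx
  exact hi x (subset_closure hx)

/-- A function that is smooth on an open set agrees near a compact subset with a function smooth
on the whole space. -/
theorem exists_contDiff_eqOn {U K : Set (Cn n)} (hU : IsOpen U) (hK : IsCompact K) (hKU : K ⊆ U) :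
    ∃ χ : Cn n → ℝ, (∀ v : Cn n → ℝ, ContDiffOn ℝ ∞ v U → ContDiff ℝ ∞ fun x => χ x * v x) ∧
      ∀ x ∈ K, χ x = 1 := by
  obtain ⟨χ, hχ, hc, hcU, h1, h01⟩ := exists_smooth_cutoff hK hU hKU
  refine ⟨χ, fun v hv => contDiff_iff_contDiffAt.2 fun x => ?_, fun x hx => h1.self_of_nhdsSet x hx⟩
  by_cases hx : x ∈ tsupport χ
  · exact hχ.contDiffAt.mul (hv.contDiffAt (hU.mem_nhds (hcU hx)))
  · refine (contDiffAt_const (c := (0 : ℝ))).congr_of_eventuallyEq ?_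
    filter_upwards [notMem_tsupport_iff_eventuallyEq.1 hx] with y hy
    rw [hy]; simp

/-- The Monge-Ampère masses of any decreasing sequence of smooth plurisubharmonic functions have
the same limit as those of the mollifications. -/
theorem IsContPSH.tendsto_of_antitone {D : Set (Cn n)} (hD : IsOpen D) {M : ℝ} {u : Cn n → ℝ}
    (hu : IsContPSH D M u) {U : Set (Cn n)} (hU : IsOpen U) (hUD : U ⊆ D) {v : ℕ → Cn n → ℝ}
    (hpsh : ∀ i, IsPSH U (v i)) (hsm : ∀ i, ContDiffOn ℝ ∞ (v i) U)
    (hanti : ∀ z ∈ U, Antitone fun i => v i z)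
    (hlim : ∀ z ∈ U, Tendsto (fun i => v i z) atTop (𝓝 (u z))) {f : Cn n → ℝ} (hf : Continuous f)
    (hfc : HasCompactSupport f) (hfU : tsupport f ⊆ U) {L : ℝ}
    (hL : Tendsto (fun i => ∫ p, f p * mongeAmpereDensity (mollify i (D.indicator u)) p)
      atTop (𝓝 L)) :
    Tendsto (fun i => ∫ p, f p * mongeAmpereDensity (v i) p) atTop (𝓝 L) := by
  obtain ⟨V, hV, hKV, hVU, hVc⟩ := exists_open_between_and_isCompact_closure hfc.isCompact hU hfU
  -- The `v i` are smooth only on `U`, while the stability estimates take functions smooth on the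
  -- whole space. Multiplying by `χ` changes nothing on `V`, and the density is local.
  obtain ⟨χ, hχ, hχ1⟩ := exists_contDiff_eqOn hU hVc hVU
  have heq : ∀ i, EqOn (v i) (fun x => χ x * v i x) V := fun i x hx => by
    simp [hχ1 x (subset_closure hx)]
  -- Dini's theorem, where the continuity of `u` is essential.
  have hdini := Antitone.tendstoUniformlyOn_of_forall_tendsto hVc
    (fun i => (hsm i).continuousOn.mono hVU) (fun x hx => hanti x (hVU hx))
    (hu.continuousOn.mono (hVU.trans hUD)) (fun x hx => hlim x (hVU hx))
  rw [Metric.tendstoUniformlyOn_iff] at hdini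
  have hclose : ∀ ε > 0, ∀ᶠ i in atTop, ∀ x ∈ V, |χ x * v i x - u x| ≤ ε := fun ε hε => by
    filter_upwards [hdini ε hε] with i hi x hx
    have h2 := heq i hx
    simp only at h2
    rw [← h2, abs_sub_comm]
    exact (hi x (subset_closure hx)).le
  have hgood : ∀ᶠ i in atTop, IsSmoothPSH V (M + 1) fun x => χ x * v i x := by
    filter_upwards [hclose 1 one_pos] with i hi
    have hs := hχ (v i) (hsm i)
    have hp : IsPSH V fun x => χ x * v i x :=
      ((hpsh i).mono (subset_closure.trans hVU)).congr (heq i)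
    refine ⟨hs, fun p hp' => hp.posSemidef_complexHessian hV hs hp', fun p hp' => ?_⟩
    have h3 := hu.bound p (hUD (hVU (subset_closure hp')))
    have h4 := abs_sub_abs_le_abs_sub (χ p * v i p) (u p)
    linarith [hi p hp']
  have hmoll : ∀ ε > 0, ∀ᶠ i in atTop, ∀ x ∈ V, |mollify i (D.indicator u) x - u x| ≤ ε :=
    fun ε hε => by
      filter_upwards [eventually_abs_mollify_sub_le hD hu.continuousOn hVc (hVU.trans hUD) hε]
        with i hi x hx
      exact hi x (subset_closure hx)
  have hsub := tendsto_integral_mongeAmpereDensity_sub hV hgood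
    ((hu.eventually_isSmoothPSH_mollify hD hV hVc (hVU.trans hUD)).mono
      fun i hi => hi.mono_bound (by linarith)) hclose hmoll hf hfc hKV
  have hfin := hsub.add hL
  simp only [sub_add_cancel, zero_add] at hfin
  refine hfin.congr fun i => integral_congr_ae (Eventually.of_forall fun p => ?_)
  by_cases hp : p ∈ tsupport f
  · have : v i =ᶠ[𝓝 p] fun x => χ x * v i x :=
      Filter.eventuallyEq_of_mem (hV.mem_nhds (hKV hp)) (heq i)
    simp only [mongeAmpereDensity_congr this]
  · simp [image_eq_zero_of_notMem_tsupport hp]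

theorem mongeAmpereDensity_add_const {u : Cn n → ℝ} (hu : ContDiff ℝ ∞ u) (c : ℝ) :
    mongeAmpereDensity (fun z => u z + c) = mongeAmpereDensity u := by
  funext p
  simp only [mongeAmpereDensity]
  rw [complexHessian_add hu contDiff_const, complexHessian_const, add_zero]

/-- The Monge-Ampère measure is computed by mollifications. -/
theorem IsMongeAmpere.tendsto_mollify {D : Set (Cn n)} (hD : IsOpen D) {M : ℝ} {u : Cn n → ℝ}
    (hu : IsContPSH D M u) {ν : Measure (Cn n)} (hν : IsMongeAmpere D u ν) {f : Cn n → ℝ}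
    (hf : Continuous f) (hfc : HasCompactSupport f) (hfD : tsupport f ⊆ D) :
    Tendsto (fun i => ∫ p, f p * mongeAmpereDensity (mollify i (D.indicator u)) p)
      atTop (𝓝 (∫ p, f p ∂ν)) := by
  obtain ⟨L, hL⟩ := hu.exists_tendsto hD hf hfc hfD
  obtain ⟨V, hV, hKV, hVD, hVc⟩ := exists_open_between_and_isCompact_closure hfc.isCompact hD hfD
  have hex : ∀ k : ℕ, ∃ i, k ≤ i ∧ IsPSH V (mollify i (D.indicator u)) ∧
      ∀ x ∈ V, |mollify i (D.indicator u) x - u x| ≤ (1 / 2 : ℝ) ^ k := fun k => by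
    obtain ⟨i, ⟨h1, h2⟩, h3⟩ := (((eventually_ge_atTop k).and
      (hu.eventually_isPSH_mollify hD hVc hVD)).and
      (eventually_abs_mollify_sub_le hD hu.continuousOn hVc hVD
        (by positivity : (0 : ℝ) < (1 / 2 : ℝ) ^ k))).exists
    exact ⟨i, h1, h2, fun x hx => h3 x (subset_closure hx)⟩
  choose ψ hψ hψp hψc using hex
  have hψt : Tendsto ψ atTop atTop := tendsto_atTop_mono hψ tendsto_id
  have hpow : Tendsto (fun k : ℕ => (1 / 2 : ℝ) ^ k) atTop (𝓝 0) :=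
    tendsto_pow_atTop_nhds_zero_of_lt_one (by norm_num) (by norm_num)
  -- A subsequence within `2⁻ᵏ` of `u` is made decreasing by adding `3 · 2⁻ᵏ`: the step from `k` to
  -- `k + 1` can raise the mollification by at most `2⁻ᵏ + 2⁻ᵏ⁻¹`, exactly the drop of the constant.
  -- Constants do not affect the density, and the subsequence identifies the limit `L` already known
  -- to exist.
  have hw := hν.weak_limit V hV (subset_closure.trans hVD)
    (fun k z => mollify (ψ k) (D.indicator u) z + 3 * (1 / 2 : ℝ) ^ k)
    (fun k => (hψp k).add_const _)
    (fun k => ((hu.contDiff_mollify hD _).add contDiff_const).contDiffOn)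
    (fun z hz => antitone_nat_of_succ_le fun k => by
      have h1 := abs_le.1 (hψc k z hz)
      have h2 := abs_le.1 (hψc (k + 1) z hz)
      have h3 : (1 / 2 : ℝ) ^ (k + 1) = (1 / 2 : ℝ) ^ k / 2 := by rw [pow_succ]; ring
      rw [h3] at h2 ⊢
      linarith [h1.1, h2.2])
    (fun z hz => by
      have h1 : Tendsto (fun k => mollify (ψ k) (D.indicator u) z) atTop (𝓝 (u z)) := by
        rw [tendsto_iff_norm_sub_tendsto_zero]
        exact squeeze_zero (fun k => norm_nonneg _) (fun k => hψc k z hz) hpow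
      simpa using h1.add (hpow.const_mul 3))
    f hf hfc hKV
  simp only [mongeAmpereDensity_add_const (hu.contDiff_mollify hD _)] at hw
  have := tendsto_nhds_unique hw (hL.comp hψt)
  rw [this]
  exact hL

end WeakLimits

/-! ### Existence, monotonicity and comparison of Monge-Ampère measures -/

noncomputable section MongeAmpereMeasures

open scoped ComplexOrder CompactlySupported

variable {n : ℕ}

theorem IsContPSH.limit_nonneg {D : Set (Cn n)} (hD : IsOpen D) {M : ℝ} {u : Cn n → ℝ}
    (hu : IsContPSH D M u) {f : Cn n → ℝ} (hfc : HasCompactSupport f)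
    (hfD : tsupport f ⊆ D) (hf0 : ∀ p, 0 ≤ f p) {L : ℝ}
    (hL : Tendsto (fun i => ∫ p, f p * mongeAmpereDensity (mollify i (D.indicator u)) p)
      atTop (𝓝 L)) : 0 ≤ L := by
  obtain ⟨V, hV, hKV, hVD, hVc⟩ := exists_open_between_and_isCompact_closure hfc.isCompact hD hfD
  refine ge_of_tendsto hL ?_
  filter_upwards [hu.eventually_isSmoothPSH_mollify hD hV hVc hVD] with i hi
  refine integral_nonneg fun p => ?_
  by_cases hp : p ∈ tsupport f
  · exact mul_nonneg (hf0 p) (mongeAmpereDensity_nonneg (hi.posSemidef p (hKV hp)))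
  · simp [image_eq_zero_of_notMem_tsupport hp]

/-- The Monge-Ampère measure of a bounded continuous plurisubharmonic function exists. -/
theorem IsContPSH.exists_isMongeAmpere {D : Set (Cn n)} (hD : IsOpen D) {M : ℝ} {u : Cn n → ℝ}
    (hu : IsContPSH D M u) : ∃ ν : Measure (Cn n), IsMongeAmpere D u ν := by
  have : LocallyCompactSpace D := hD.locallyCompactSpace
  -- The Riesz theorem is applied on the locally compact space `D`, since the masses are controlled
  -- only on compact subsets of `D`. Test functions on `D` are extended by zero, and the measure is
  -- pushed forward at the end.
  set ext : C_c(D, ℝ) → Cn n → ℝ := fun f => Function.extend Subtype.val f 0 with hext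
  have hval : ∀ (f : C_c(D, ℝ)) (x : D), ext f x = f x := fun f x =>
    Subtype.val_injective.extend_apply _ _ _
  have hout : ∀ (f : C_c(D, ℝ)) (x : Cn n), x ∉ D → ext f x = 0 := fun f x hx =>
    Function.extend_apply' _ _ _ fun ⟨y, hy⟩ => hx (hy ▸ y.2)
  have hcont : ∀ f, Continuous (ext f) := fun f =>
    f.hasCompactSupport.continuous_extend_zero hD f.continuous
  have hK : ∀ f : C_c(D, ℝ), IsCompact (Subtype.val '' tsupport f) := fun f =>
    f.hasCompactSupport.isCompact.image continuous_subtype_val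
  have hsuppK : ∀ f : C_c(D, ℝ), tsupport (ext f) ⊆ Subtype.val '' tsupport f := fun f => by
    refine closure_minimal (fun x hx => ?_) (hK f).isClosed
    by_cases hxD : x ∈ D
    · refine ⟨⟨x, hxD⟩, subset_tsupport _ ?_, rfl⟩
      rw [Function.mem_support, ← hval f ⟨x, hxD⟩]
      exact hx
    · exact absurd (hout f x hxD) hx
  have hcs : ∀ f, HasCompactSupport (ext f) := fun f =>
    (hK f).of_isClosed_subset (isClosed_tsupport _) (hsuppK f)
  have hsub : ∀ f, tsupport (ext f) ⊆ D := fun f x hx => by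
    obtain ⟨y, -, rfl⟩ := hsuppK f hx
    exact y.2
  have hmol := hu.contDiff_mollify hD
  have hint : ∀ f i, Integrable fun p => ext f p *
      mongeAmpereDensity (mollify i (D.indicator u)) p := fun f i =>
    integrable_mul_mongeAmpereDensity (hcont f) (hcs f) (hmol i)
  choose Λ hΛ using fun f => hu.exists_tendsto hD (hcont f) (hcs f) (hsub f)
  have hadd : ∀ f g, Λ (f + g) = Λ f + Λ g := fun f g => by
    refine tendsto_nhds_unique (hΛ (f + g)) (((hΛ f).add (hΛ g)).congr fun i => ?_)
    rw [← integral_add (hint f i) (hint g i)]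
    refine integral_congr_ae (Eventually.of_forall fun p => ?_)
    by_cases hp : p ∈ D
    · have h1 := hval (f + g) ⟨p, hp⟩
      have h2 := hval f ⟨p, hp⟩
      have h3 := hval g ⟨p, hp⟩
      simp only at h1 h2 h3
      simp only [h1, h2, h3, CompactlySupportedContinuousMap.coe_add, Pi.add_apply]
      ring
    · simp [hout _ p hp]
  have hsmul : ∀ (c : ℝ) f, Λ (c • f) = c • Λ f := fun c f => by
    refine tendsto_nhds_unique (hΛ (c • f)) (((hΛ f).const_smul c).congr fun i => ?_)
    rw [smul_eq_mul, ← integral_const_mul]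
    refine integral_congr_ae (Eventually.of_forall fun p => ?_)
    by_cases hp : p ∈ D
    · have h1 := hval (c • f) ⟨p, hp⟩
      have h2 := hval f ⟨p, hp⟩
      simp only at h1 h2
      simp only [h1, h2, CompactlySupportedContinuousMap.coe_smul, Pi.smul_apply, smul_eq_mul]
      ring
    · simp [hout _ p hp]
  set Λl : C_c(D, ℝ) →ₗ[ℝ] ℝ := { toFun := Λ, map_add' := hadd, map_smul' := hsmul }
  set Λp : C_c(D, ℝ) →ₚ[ℝ] ℝ := PositiveLinearMap.mk₀ Λl fun f hf =>
    hu.limit_nonneg hD (hcs f) (hsub f) (fun p => by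
      by_cases hp : p ∈ D
      · have h1 := hval f ⟨p, hp⟩
        simp only at h1
        rw [h1]; exact hf _
      · rw [hout f p hp]) (hΛ f)
  set ρ := RealRMK.rieszMeasure Λp
  have hemb : MeasurableEmbedding (Subtype.val : D → Cn n) :=
    MeasurableEmbedding.subtype_coe hD.measurableSet
  refine ⟨ρ.map Subtype.val, ⟨fun K hKc hKD => ?_, ?_⟩⟩
  · rw [hemb.map_apply]
    have : IsCompact (Subtype.val ⁻¹' K : Set D) :=
      Topology.IsInducing.subtypeVal.isCompact_preimage_iff (by simpa using hKD) |>.2 hKc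
    exact this.measure_lt_top
  · intro U hU hUD v hpsh hsm hanti hlim f hf hfc hfU
    have hfDc : HasCompactSupport fun x : D => f x := by
      refine HasCompactSupport.intro (K := Subtype.val ⁻¹' tsupport f)
        (Topology.IsInducing.subtypeVal.isCompact_preimage_iff
          (by simpa using hfU.trans hUD) |>.2 hfc.isCompact) fun x hx => ?_
      exact image_eq_zero_of_notMem_tsupport hx
    set F : C_c(D, ℝ) := ⟨⟨fun x : D => f x, hf.comp continuous_subtype_val⟩, hfDc⟩ with hF
    have hFf : ext F = f := by
      funext x
      by_cases hx : x ∈ D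
      · exact hval F ⟨x, hx⟩
      · rw [hout F x hx]
        exact (image_eq_zero_of_notMem_tsupport fun h => hx (hUD (hfU h))).symm
    have hL := hΛ F
    rw [hFf] at hL
    have hval2 : ∫ z, f z ∂(ρ.map Subtype.val) = Λ F := by
      rw [hemb.integral_map]
      exact RealRMK.integral_rieszMeasure Λp F
    rw [hval2]
    exact hu.tendsto_of_antitone hD hU hUD hpsh hsm hanti hlim hf hfc hfU hL

theorem IsMongeAmpere.mono {D W : Set (Cn n)} {u : Cn n → ℝ} {ν : Measure (Cn n)}
    (h : IsMongeAmpere D u ν) (hWD : W ⊆ D) : IsMongeAmpere W u ν :=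
  ⟨fun K hK hKW => h.finite_on_compacts K hK (hKW.trans hWD),
    fun U hU hUW => h.weak_limit U hU (hUW.trans hWD)⟩

/-- Adding a plurisubharmonic function increases the Monge-Ampère measure. -/
theorem IsMongeAmpere.integral_le_of_add {W : Set (Cn n)} (hW : IsOpen W) {M M' M'' : ℝ}
    {w h u : Cn n → ℝ} (hw : IsContPSH W M w) (hh : IsContPSH W M' h) (hu : IsContPSH W M'' u)
    (huw : ∀ x ∈ W, u x = w x + h x) {ν ν' : Measure (Cn n)} (hν : IsMongeAmpere W w ν)
    (hν' : IsMongeAmpere W u ν') {f : Cn n → ℝ} (hf : Continuous f) (hfc : HasCompactSupport f)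
    (hfW : tsupport f ⊆ W) (hf0 : ∀ p, 0 ≤ f p) : ∫ p, f p ∂ν ≤ ∫ p, f p ∂ν' := by
  refine le_of_tendsto_of_tendsto (hν.tendsto_mollify hW hw hf hfc hfW)
    (hν'.tendsto_mollify hW hu hf hfc hfW) ?_
  obtain ⟨V, hV, hKV, hVW, hVc⟩ := exists_open_between_and_isCompact_closure hfc.isCompact hW hfW
  filter_upwards [hw.eventually_isSmoothPSH_mollify hW hV hVc hVW,
    hh.eventually_isSmoothPSH_mollify hW hV hVc hVW] with i hwi hhi
  refine integral_mono (integrable_mul_mongeAmpereDensity hf hfc (hw.contDiff_mollify hW i))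
    (integrable_mul_mongeAmpereDensity hf hfc (hu.contDiff_mollify hW i)) fun p => ?_
  by_cases hp : p ∈ tsupport f
  · refine mul_le_mul_of_nonneg_left ?_ (hf0 p)
    -- Mollification is additive, so at each smooth stage the Hessian of `u` is the sum of two
    -- positive semidefinite ones, and monotonicity of the determinant applies before passing to the
    -- limit.
    have hsum : mollify i (W.indicator u) =
        fun x => mollify i (W.indicator w) x + mollify i (W.indicator h) x := by
      funext x
      rw [← mollify_add i (hw.continuousOn.measurable_indicator hW)
        (hh.continuousOn.measurable_indicator hW) (abs_indicator_le hw.nonneg hw.bound)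
        (abs_indicator_le hh.nonneg hh.bound)]
      congr 1
      funext y
      by_cases hy : y ∈ W
      · simp [hy, huw y hy]
      · simp [hy]
    simp only [mongeAmpereDensity]
    rw [hsum, complexHessian_add hwi.contDiff hhi.contDiff]
    exact mul_le_mul_of_nonneg_left
      ((hwi.posSemidef p (hKV hp)).det_re_le_det_add (hhi.posSemidef p (hKV hp))) (by positivity)
  · simp [image_eq_zero_of_notMem_tsupport hp]

/-- A cutoff `χ` between a compact `K` and an open `O` gives `ν K ≤ ∫ χ dν ≤ ∫ χ dν' ≤ ν' O`. Inner
regularity yields the inequality on open sets and outer regularity on all measurable sets;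
finiteness on the ball provides this regularity. -/
theorem restrict_ball_le_of_integral_le {ν ν' : Measure (Cn n)} {p : Cn n} {ρ : ℝ}
    (hfin : ν (Metric.ball p ρ) < ⊤) (hfin' : ν' (Metric.ball p ρ) < ⊤)
    (h : ∀ f : Cn n → ℝ, Continuous f → HasCompactSupport f → tsupport f ⊆ Metric.ball p ρ →
      (∀ x, 0 ≤ f x) → ∫ x, f x ∂ν ≤ ∫ x, f x ∂ν') :
    ν.restrict (Metric.ball p ρ) ≤ ν'.restrict (Metric.ball p ρ) := by
  set U := Metric.ball p ρ with hU
  have hUo : IsOpen U := Metric.isOpen_ball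
  have : IsFiniteMeasure (ν.restrict U) := ⟨by rwa [Measure.restrict_apply_univ]⟩
  have : IsFiniteMeasure (ν'.restrict U) := ⟨by rwa [Measure.restrict_apply_univ]⟩
  have hopen : ∀ O : Set (Cn n), IsOpen O → O ⊆ U → ν.restrict U O ≤ ν'.restrict U O := by
    intro O hO hOU
    rw [hO.measure_eq_iSup_isCompact]
    refine iSup₂_le fun K hKO => iSup_le fun hK => ?_
    obtain ⟨χ, hχ, hc, hcO, h1, h01⟩ := exists_smooth_cutoff hK hO hKO
    have hrestr : ∀ m : Measure (Cn n), ∫ x, χ x ∂(m.restrict U) = ∫ x, χ x ∂m := fun m =>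
      setIntegral_eq_integral_of_forall_compl_eq_zero fun x hx =>
        image_eq_zero_of_notMem_tsupport fun hx' => hx (hOU (hcO hx'))
    have hle := h χ hχ.continuous hc (hcO.trans hOU) fun x => (h01 x).1
    rw [← hrestr ν, ← hrestr ν'] at hle
    have hint : ∀ m : Measure (Cn n), IsFiniteMeasure m → Integrable χ m := fun m _ =>
      hχ.continuous.integrable_of_hasCompactSupport hc
    have hl : (ν.restrict U).real K ≤ ∫ x, χ x ∂(ν.restrict U) := by
      rw [← integral_indicator_one hK.measurableSet]
      refine integral_mono ((integrable_indicator_iff hK.measurableSet).2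
        (integrableOn_const (measure_lt_top _ _).ne)) (hint _ inferInstance) fun x => ?_
      by_cases hx : x ∈ K
      · simp [hx, h1.self_of_nhdsSet x hx]
      · simp [hx, (h01 x).1]
    have hr : ∫ x, χ x ∂(ν'.restrict U) ≤ (ν'.restrict U).real O := by
      rw [← integral_indicator_one hO.measurableSet]
      refine integral_mono (hint _ inferInstance) ((integrable_indicator_iff hO.measurableSet).2
        (integrableOn_const (measure_lt_top _ _).ne)) fun x => ?_
      by_cases hx : x ∈ O
      · simp [hx, (h01 x).2]
      · simp [hx, image_eq_zero_of_notMem_tsupport fun h => hx (hcO h)]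
    exact (ENNReal.toReal_le_toReal (measure_lt_top _ _).ne (measure_lt_top _ _).ne).1
      (hl.trans (hle.trans hr))
  refine Measure.le_iff.2 fun A hA => ?_
  rw [A.measure_eq_iInf_isOpen (ν'.restrict U)]
  refine le_iInf₂ fun O hAO => le_iInf fun hO => ?_
  have h2 : ∀ m : Measure (Cn n), m.restrict U O = m.restrict U (O ∩ U) := fun m => by
    rw [Measure.restrict_apply hO.measurableSet,
      Measure.restrict_apply (hO.inter hUo).measurableSet, inter_assoc, inter_self]
  calc ν.restrict U A ≤ ν.restrict U O := measure_mono hAO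
    _ = ν.restrict U (O ∩ U) := h2 ν
    _ ≤ ν'.restrict U (O ∩ U) := hopen _ (hO.inter hUo) inter_subset_right
    _ = ν'.restrict U O := (h2 ν').symm

/-- An inequality between measures is a local property. -/
theorem restrict_le_of_forall_mem_nhds {X : Type*} [TopologicalSpace X]
    [SecondCountableTopology X] [MeasurableSpace X] [OpensMeasurableSpace X] {D : Set X}
    {ν ν' : Measure X}
    (h : ∀ p ∈ D, ∃ U, IsOpen U ∧ p ∈ U ∧ ν.restrict U ≤ ν'.restrict U) :
    ν.restrict D ≤ ν'.restrict D := by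
  choose! U hUo hpU hU using h
  obtain ⟨T, hTD, hTc, hT⟩ := TopologicalSpace.countable_cover_nhdsWithin
    (f := U) (s := D) fun p hp => mem_nhdsWithin_of_mem_nhds ((hUo p hp).mem_nhds (hpU p hp))
  have hbig : ν.restrict (⋃ p ∈ T, U p) ≤ ν'.restrict (⋃ p ∈ T, U p) := by
    rcases T.eq_empty_or_nonempty with rfl | hne
    · simp
    obtain ⟨e, he⟩ := hTc.exists_eq_range hne
    have hUn : (⋃ p ∈ T, U p) = ⋃ k, U (e k) := by rw [he, biUnion_range]
    have heD : ∀ k, e k ∈ D := fun k => hTD (he ▸ mem_range_self k)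
    have hm : ∀ k, MeasurableSet (disjointed (fun k => U (e k)) k) :=
      MeasurableSet.disjointed fun k => (hUo _ (heD k)).measurableSet
    -- A countable subcover is made disjoint, so that both measures are sums of their restrictions
    -- and can be compared term by term.
    rw [hUn, ← iUnion_disjointed, Measure.restrict_iUnion (disjoint_disjointed _) hm,
      Measure.restrict_iUnion (disjoint_disjointed _) hm]
    refine Measure.le_iff.2 fun A hA => ?_
    rw [Measure.sum_apply _ hA, Measure.sum_apply _ hA]
    refine ENNReal.tsum_le_tsum fun k => ?_
    have hk := Measure.restrict_mono_measure (hU _ (heD k)) (disjointed (fun k => U (e k)) k)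
    rw [Measure.restrict_restrict (hm k), Measure.restrict_restrict (hm k),
      inter_eq_self_of_subset_left (disjointed_subset _ _)] at hk
    exact hk A
  have := Measure.restrict_mono_measure hbig D
  have hmu : MeasurableSet (⋃ p ∈ T, U p) :=
    (isOpen_biUnion fun p hp => hUo p (hTD hp)).measurableSet
  rwa [Measure.restrict_restrict_of_subset hT, Measure.restrict_restrict_of_subset hT] at this

end MongeAmpereMeasures

/-! ### Plurisubharmonicity as a local property, and operations preserving it -/

noncomputable section LocalPlurisubharmonicity

theorem circleAverage_mul_left {f : ℂ → ℝ} {c : ℂ} (hc : ‖c‖ = 1) :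
    Real.circleAverage (fun ζ => f (c * ζ)) 0 1 = Real.circleAverage f 0 1 := by
  have h := Real.circleAverage_eq_integral_add (f := f) (c := 0) (R := 1) c.arg
  rw [h, Real.circleAverage_def]
  have : ∀ θ : ℝ, circleMap 0 1 (θ + c.arg) = c * circleMap 0 1 θ := fun θ => by
    have hce : c = Complex.exp (c.arg * Complex.I) := by
      conv_lhs => rw [← Complex.norm_mul_exp_arg_mul_I c, hc]
      simp
    simp only [circleMap, zero_add, Complex.ofReal_one, one_mul]
    conv_rhs => rw [hce]
    rw [← Complex.exp_add]
    congr 1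
    push_cast
    ring
  simp only [this]

/-- Pairing `ζ` with `-ζ`, the parallelogram law makes the integrand constant on the circle. -/
theorem circleAverage_norm_add_smul_sq {E : Type*} [NormedAddCommGroup E] [InnerProductSpace ℂ E]
    (x y : E) : Real.circleAverage (fun ζ : ℂ => ‖x + ζ • y‖ ^ 2) 0 1 = ‖x‖ ^ 2 + ‖y‖ ^ 2 := by
  have hc : Continuous fun ζ : ℂ => ‖x + ζ • y‖ ^ 2 := by fun_prop
  have hc' : Continuous fun ζ : ℂ => ‖x + ((-1) * ζ) • y‖ ^ 2 := by fun_prop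
  have h1 := circleAverage_mul_left (f := fun ζ : ℂ => ‖x + ζ • y‖ ^ 2) (c := -1) (by simp)
  have hi := hc.continuousOn.circleIntegrable (c := 0) zero_le_one
  have hi' := hc'.continuousOn.circleIntegrable (c := 0) zero_le_one
  have h2 := Real.circleAverage_fun_add hi hi'
  have h3 : EqOn (fun ζ : ℂ => ‖x + ζ • y‖ ^ 2 + ‖x + ((-1) * ζ) • y‖ ^ 2)
      (fun _ => 2 * (‖x‖ ^ 2 + ‖y‖ ^ 2)) (Metric.sphere 0 |1|) := fun ζ hζ => by
    have hζ1 : ‖ζ‖ = 1 := by simpa using hζ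
    have h4 := parallelogram_law_with_norm ℂ x (ζ • y)
    have h5 : x + ((-1) * ζ) • y = x - ζ • y := by simp [sub_eq_add_neg]
    simp only [h5]
    rw [norm_smul ζ y, hζ1, one_mul] at h4
    nlinarith [h4]
  rw [Real.circleAverage_congr_sphere h3, Real.circleAverage_const, h1] at h2
  linarith

/-- The sub-mean value inequality on small circles in a disc implies it on the disc. -/
theorem le_circleAverage_of_local {g : ℂ → ℝ} (hg : Continuous g) {s₀ : ℝ} (hs₀ : 0 < s₀)
    (hloc : ∀ (ζ : ℂ) (s : ℝ), 0 < s → s ≤ s₀ → Metric.closedBall ζ s ⊆ Metric.closedBall 0 1 →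
      g ζ ≤ Real.circleAverage g ζ s) : g 0 ≤ Real.circleAverage g 0 1 := by
  -- Averaging over rotations keeps the value at `0` and the local inequality, and makes the
  -- function constant on the unit circle with value the average of `g`. The maximum principle for
  -- `G` then replaces the solution of a Dirichlet problem.
  set G : ℂ → ℝ := fun ζ => Real.circleAverage (fun η => g (η * ζ)) 0 1 with hG
  have hpi : (0 : ℝ) ≤ 2 * Real.pi := by positivity
  have hGc : Continuous G := by
    simp only [hG, Real.circleAverage_def, smul_eq_mul]
    refine continuous_const.mul ?_
    refine intervalIntegral.continuous_parametric_intervalIntegral_of_continuous' ?_ _ _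
    have := continuous_circleMap 0 1
    simp only [Function.uncurry_def]
    fun_prop
  have hG1 : ∀ ζ : ℂ, ‖ζ‖ = 1 → G ζ = Real.circleAverage g 0 1 := fun ζ hζ => by
    simp only [hG, mul_comm _ ζ]
    exact circleAverage_mul_left hζ
  have hG0 : G 0 = g 0 := by simp [hG, Real.circleAverage_const]
  have hGsub : ∀ (ζ : ℂ) (s : ℝ), 0 < s → s ≤ s₀ →
      Metric.closedBall ζ s ⊆ Metric.closedBall 0 1 → G ζ ≤ Real.circleAverage G ζ s := by
    intro ζ s hs hss hsub
    have hswap : Real.circleAverage G ζ s =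
        Real.circleAverage (fun η => Real.circleAverage (fun ξ => g (η * ξ)) ζ s) 0 1 := by
      simp only [hG, Real.circleAverage_def, smul_eq_mul, intervalIntegral.integral_const_mul]
      congr 2
      have hcont : Continuous fun q : ℝ × ℝ => g (circleMap 0 1 q.2 * circleMap ζ s q.1) := by
        have h1 := continuous_circleMap 0 1
        have h2 := continuous_circleMap ζ s
        fun_prop
      have := intervalIntegral_integral_swap (μ := (volume : Measure ℝ).restrict
        (Ioc 0 (2 * Real.pi))) (a := 0) (b := 2 * Real.pi)
        (f := fun x y => g (circleMap 0 1 y * circleMap ζ s x)) ?_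
      · simp only [intervalIntegral.integral_of_le hpi] at this ⊢
        exact this
      · rw [uIoc_of_le hpi, Measure.prod_restrict]
        refine (hcont.continuousOn.integrableOn_compact
          (isCompact_Icc.prod isCompact_Icc)).mono_set
          (prod_mono Ioc_subset_Icc_self Ioc_subset_Icc_self)
    rw [hswap]
    refine Real.circleAverage_mono ?_ ?_ fun η hη => ?_
    · exact (hg.comp (continuous_id.mul continuous_const)).continuousOn.circleIntegrable zero_le_one
    · refine Continuous.continuousOn ?_ |>.circleIntegrable zero_le_one
      simp only [Real.circleAverage_def, smul_eq_mul]
      refine continuous_const.mul ?_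
      refine intervalIntegral.continuous_parametric_intervalIntegral_of_continuous' ?_ _ _
      have := continuous_circleMap ζ s
      simp only [Function.uncurry_def]
      fun_prop
    · have hη1 : ‖η‖ = 1 := by simpa using hη
      have h1 := hloc (η * ζ) s hs hss fun ξ hξ => by
        have h2 : η⁻¹ * ξ ∈ Metric.closedBall ζ s := by
          rw [Metric.mem_closedBall, dist_eq_norm] at hξ ⊢
          have h3 : η⁻¹ * ξ - ζ = η⁻¹ * (ξ - η * ζ) := by
            have : η ≠ 0 := by rw [← norm_ne_zero_iff, hη1]; exact one_ne_zero
            field_simp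
          rw [h3, norm_mul, norm_inv, hη1, inv_one, one_mul]
          exact hξ
        have h4 := hsub h2
        rw [mem_closedBall_zero_iff] at h4 ⊢
        rwa [norm_mul, norm_inv, hη1, inv_one, one_mul] at h4
      refine h1.trans (le_of_eq ?_)
      rw [Real.circleAverage_eq_circleAverage_zero_one,
        Real.circleAverage_eq_circleAverage_zero_one (f := fun ξ => g (η * ξ)),
        ← circleAverage_mul_left (f := fun z => g (s * z + η * ζ)) hη1]
      congr 1
      funext z
      congr 1
      ring
  refine le_of_forall_pos_le_add fun ε hε => ?_
  -- The quadratic term makes the local inequality strict, so a maximum over the closed disc can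
  -- only lie on its boundary.
  set k : ℂ → ℝ := fun ζ => G ζ + ε * ‖ζ‖ ^ 2 with hk
  have hkc : Continuous k := by fun_prop
  obtain ⟨ζ₀, hζ₀, hmax⟩ := (isCompact_closedBall (0 : ℂ) 1).exists_isMaxOn
    ⟨0, by simp⟩ hkc.continuousOn
  have hζ₀1 : ‖ζ₀‖ = 1 := by
    by_contra hne
    have hlt : ‖ζ₀‖ < 1 := lt_of_le_of_ne (by simpa using hζ₀) hne
    set s := min s₀ (1 - ‖ζ₀‖) with hs
    have hs0 : 0 < s := lt_min hs₀ (by linarith)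
    have hsub : Metric.closedBall ζ₀ s ⊆ Metric.closedBall 0 1 := fun ξ hξ => by
      rw [mem_closedBall_zero_iff]
      have h1 := norm_sub_norm_le ξ ζ₀
      rw [Metric.mem_closedBall, dist_eq_norm] at hξ
      linarith [min_le_right s₀ (1 - ‖ζ₀‖)]
    have h1 : Real.circleAverage k ζ₀ s ≤ k ζ₀ :=
      Real.circleAverage_mono_on_of_le_circle (hkc.continuousOn.circleIntegrable hs0.le)
        fun ξ hξ => hmax (hsub (by
          rw [abs_of_pos hs0] at hξ
          exact Metric.sphere_subset_closedBall hξ))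
    have hsq : Real.circleAverage (fun ζ : ℂ => ε * ‖ζ‖ ^ 2) ζ₀ s = ε * (‖ζ₀‖ ^ 2 + s ^ 2) := by
      rw [Real.circleAverage_eq_circleAverage_zero_one]
      have h3 : (fun z : ℂ => ε * ‖(s : ℂ) * z + ζ₀‖ ^ 2) =
          fun z : ℂ => ε • ‖ζ₀ + z • (s : ℂ)‖ ^ 2 := by
        funext z
        rw [smul_eq_mul, smul_eq_mul, add_comm ζ₀, mul_comm z]
      rw [h3, Real.circleAverage_fun_smul, circleAverage_norm_add_smul_sq, smul_eq_mul,
        Complex.norm_real, Real.norm_of_nonneg hs0.le]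
    have h2 : Real.circleAverage k ζ₀ s =
        Real.circleAverage G ζ₀ s + ε * (‖ζ₀‖ ^ 2 + s ^ 2) := by
      rw [← hsq, ← Real.circleAverage_fun_add (hGc.continuousOn.circleIntegrable hs0.le)
        (Continuous.continuousOn (by fun_prop) |>.circleIntegrable hs0.le)]
    have h4 := hGsub ζ₀ s hs0 (min_le_left _ _) hsub
    have h5 : 0 < ε * s ^ 2 := by positivity
    rw [h2] at h1
    simp only [hk] at h1
    linarith
  have h0 : k 0 ≤ k ζ₀ := hmax (show (0 : ℂ) ∈ Metric.closedBall 0 1 by simp)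
  simp only [hk, hG0, norm_zero, hG1 ζ₀ hζ₀1, hζ₀1] at h0
  linarith

variable {n : ℕ}

theorem circleIntegrable_comp_disc {D : Set (Cn n)} {u : Cn n → ℝ} (hu : ContinuousOn u D)
    {a b : Cn n} (hab : ∀ ζ : ℂ, ‖ζ‖ ≤ 1 → a + ζ • b ∈ D) :
    CircleIntegrable (fun ζ : ℂ => u (a + ζ • b)) 0 1 := by
  refine ContinuousOn.circleIntegrable zero_le_one ?_
  refine hu.comp (Continuous.continuousOn (by fun_prop)) fun ζ hζ => hab ζ ?_
  have : ‖ζ‖ = 1 := by simpa using hζ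
  exact this.le

/-- Plurisubharmonicity of a continuous function is a local property. -/
theorem IsPSH.of_local {D : Set (Cn n)} {u : Cn n → ℝ} (hu : ContinuousOn u D)
    (hloc : ∀ p ∈ D, ∃ W, IsOpen W ∧ p ∈ W ∧ IsPSH W u) : IsPSH D u := by
  refine ⟨hu.upperSemicontinuousOn, fun a b hab => ⟨circleIntegrable_comp_disc hu hab, ?_⟩⟩
  choose! W hWo hpW hW using hloc
  have hdisc : Continuous fun ζ : ℂ => a + ζ • b := by fun_prop
  set K : Set (Cn n) := (fun ζ : ℂ => a + ζ • b) '' Metric.closedBall 0 1 with hK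
  have hKc : IsCompact K := (isCompact_closedBall _ _).image hdisc
  have hKD : K ⊆ D := by
    rintro _ ⟨ζ, hζ, rfl⟩
    exact hab ζ (by simpa using hζ)
  -- By a Lebesgue number every sufficiently small subdisc is mapped into a single `W p`, where the
  -- sub-mean inequality is available.
  obtain ⟨δ, hδ, hleb⟩ := lebesgue_number_lemma_of_metric (c := fun p : D => W p) hKc
    (fun p => hWo p p.2) fun x hx => mem_iUnion.2 ⟨⟨x, hKD hx⟩, hpW x (hKD hx)⟩
  -- The radial retraction onto the unit disc extends `u` along the disc to a continuous function on
  -- all of `ℂ`, as the one-variable lemma requires.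
  set ret : ℂ → ℂ := fun ζ => ((max 1 ‖ζ‖)⁻¹ : ℝ) • ζ with hret
  have hretc : Continuous ret := by
    have hm : Continuous fun ζ : ℂ => max 1 ‖ζ‖ := by fun_prop
    refine (hm.inv₀ fun ζ => ?_).smul continuous_id
    exact (lt_of_lt_of_le one_pos (le_max_left _ _)).ne'
  have hret1 : ∀ ζ, ‖ret ζ‖ ≤ 1 := fun ζ => by
    have h0 : 0 < max 1 ‖ζ‖ := lt_of_lt_of_le one_pos (le_max_left _ _)
    rw [hret, norm_smul, Real.norm_of_nonneg (inv_nonneg.2 h0.le), inv_mul_le_iff₀ h0, mul_one]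
    exact le_max_right _ _
  have hretid : ∀ ζ : ℂ, ‖ζ‖ ≤ 1 → ret ζ = ζ := fun ζ hζ => by
    simp [hret, max_eq_left hζ]
  set g : ℂ → ℝ := fun ζ => u (a + ret ζ • b) with hg
  have hgc : Continuous g :=
    hu.comp_continuous (hdisc.comp hretc) fun ζ => hab _ (hret1 ζ)
  have hmain := le_circleAverage_of_local hgc (s₀ := δ / (2 * (‖b‖ + 1))) (by positivity)
    fun ζ s hs hss hsub => by
      have hζ1 : ‖ζ‖ ≤ 1 := by simpa using hsub (Metric.mem_closedBall_self hs.le)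
      obtain ⟨p, hp⟩ := hleb (a + ζ • b) ⟨ζ, by simpa using hζ1, rfl⟩
      have hsb : s * ‖b‖ < δ := by
        rw [le_div_iff₀ (by positivity)] at hss
        nlinarith [norm_nonneg b]
      have h1 := ((hW p p.2).subMean (a + ζ • b) ((s : ℂ) • b) fun η hη => hp (by
        rw [Metric.mem_ball, dist_self_add_left, norm_smul, norm_smul, Complex.norm_real,
          Real.norm_of_nonneg hs.le]
        exact lt_of_le_of_lt (mul_le_of_le_one_left (by positivity) hη) hsb)).2
      simp only [hg, hretid ζ hζ1]
      refine h1.trans (le_of_eq ?_)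
      rw [Real.circleAverage_eq_circleAverage_zero_one (c := ζ)]
      refine Real.circleAverage_congr_sphere fun η hη => ?_
      have hη1 : ‖η‖ = 1 := by simpa using hη
      have h2 : ‖(s : ℂ) * η + ζ‖ ≤ 1 := by
        have h3 : (s : ℂ) * η + ζ ∈ Metric.closedBall ζ s := by
          rw [Metric.mem_closedBall, dist_eq_norm, add_sub_cancel_right, norm_mul, hη1,
            Complex.norm_real, Real.norm_of_nonneg hs.le, mul_one]
        simpa using hsub h3
      simp only [hretid _ h2]
      congr 1
      rw [add_smul, smul_smul, mul_comm η]
      abel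
  have hg0 : g 0 = u a := by simp [hg, hret]
  rw [hg0] at hmain
  refine hmain.trans (le_of_eq (Real.circleAverage_congr_sphere fun η hη => ?_))
  have hη1 : ‖η‖ = 1 := by simpa using hη
  simp only [hg, hretid η hη1.le]

theorem IsPSH.add {D : Set (Cn n)} {u v : Cn n → ℝ} (hu : IsPSH D u) (hv : IsPSH D v) :
    IsPSH D fun z => u z + v z := by
  refine ⟨hu.usc.add hv.usc, fun a b hab => ?_⟩
  obtain ⟨hi, hle⟩ := hu.subMean a b hab
  obtain ⟨hi', hle'⟩ := hv.subMean a b hab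
  refine ⟨hi.add hi', ?_⟩
  rw [Real.circleAverage_fun_add hi hi']
  exact add_le_add hle hle'

theorem IsPSH.max {D : Set (Cn n)} {u v : Cn n → ℝ} (hu : IsPSH D u) (hv : IsPSH D v)
    (hcu : ContinuousOn u D) (hcv : ContinuousOn v D) : IsPSH D fun z => max (u z) (v z) := by
  have hc : ContinuousOn (fun z => Max.max (u z) (v z)) D := hcu.sup hcv
  refine ⟨hc.upperSemicontinuousOn, fun a b hab => ⟨circleIntegrable_comp_disc hc hab, ?_⟩⟩
  obtain ⟨hi, hle⟩ := hu.subMean a b hab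
  obtain ⟨hi', hle'⟩ := hv.subMean a b hab
  have hm := circleIntegrable_comp_disc hc hab
  exact max_le (hle.trans (Real.circleAverage_mono hi hm fun ζ _ => le_max_left _ _))
    (hle'.trans (Real.circleAverage_mono hi' hm fun ζ _ => le_max_right _ _))

theorem isPSH_const (D : Set (Cn n)) (c : ℝ) : IsPSH D fun _ => c :=
  ⟨upperSemicontinuousOn_const, fun _ _ _ => ⟨circleIntegrable_const c 0 1,
    (Real.circleAverage_const c 0 1).ge⟩⟩

theorem IsPSH.sum {ι : Type*} {D : Set (Cn n)} (s : Finset ι) {u : ι → Cn n → ℝ}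
    (hu : ∀ i ∈ s, IsPSH D (u i)) : IsPSH D fun z => ∑ i ∈ s, u i z := by
  classical
  induction s using Finset.induction_on with
  | empty => simpa using isPSH_const D 0
  | insert i s hi ih =>
    simp only [Finset.sum_insert hi]
    exact (hu i (Finset.mem_insert_self i s)).add
      (ih fun j hj => hu j (Finset.mem_insert_of_mem hj))

theorem isPSH_quadratic (D : Set (Cn n)) (c : Cn n) {A : ℝ} (hA : 0 ≤ A) (s : ℝ) :
    IsPSH D fun z => A * (‖z - c‖ ^ 2 - s) := by
  have hc : Continuous fun z : Cn n => A * (‖z - c‖ ^ 2 - s) := by fun_prop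
  refine ⟨hc.upperSemicontinuous.upperSemicontinuousOn _, fun a b hab =>
    ⟨circleIntegrable_comp_disc hc.continuousOn hab, ?_⟩⟩
  have h1 : (fun ζ : ℂ => A * (‖a + ζ • b - c‖ ^ 2 - s)) =
      fun ζ : ℂ => A • ‖(a - c) + ζ • b‖ ^ 2 + -(A * s) := by
    funext ζ
    rw [smul_eq_mul, add_sub_right_comm]
    ring
  have hi : CircleIntegrable (fun ζ : ℂ => A • ‖(a - c) + ζ • b‖ ^ 2) 0 1 :=
    Continuous.continuousOn (by fun_prop) |>.circleIntegrable zero_le_one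
  rw [h1, Real.circleAverage_fun_add hi (circleIntegrable_const _ 0 1), Real.circleAverage_const,
    Real.circleAverage_fun_smul, circleAverage_norm_add_smul_sq, smul_eq_mul]
  nlinarith [mul_nonneg hA (sq_nonneg ‖b‖)]

end LocalPlurisubharmonicity

/-! ### Hölder functions and the gluing construction -/

noncomputable section Gluing

variable {n : ℕ}

theorem isHolderOn_iff {S : Set (Cn n)} {u : Cn n → ℝ} :
    IsHolderOn S u ↔ ∃ C α : ℝ, 0 ≤ C ∧ 0 < α ∧ α ≤ 1 ∧
      ∀ x ∈ S, ∀ y ∈ S, |u x - u y| ≤ C * dist x y ^ α := by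
  constructor
  · rintro ⟨C, α, h0, h1, h⟩
    exact ⟨C, α, C.2, h0, h1, fun x hx y hy => h.dist_le hx hy⟩
  · rintro ⟨C, α, hC, h0, h1, h⟩
    lift C to ℝ≥0 using hC
    lift α to ℝ≥0 using h0.le
    refine ⟨C, α, h0, h1, fun x hx y hy => ?_⟩
    rw [edist_nndist, edist_nndist, ← ENNReal.coe_rpow_of_nonneg _ α.coe_nonneg, ← ENNReal.coe_mul,
      ENNReal.coe_le_coe, ← NNReal.coe_le_coe]
    exact h x hx y hy

/-- On a bounded set a Hölder exponent may be lowered at the cost of the constant; this lets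
functions with different exponents be added. -/
theorem Real.rpow_le_one_add_mul_rpow {d R α β : ℝ} (hd : 0 ≤ d) (hR : d ≤ R) (hβ : 0 ≤ β)
    (hβα : β ≤ α) (hα : α ≤ 1) : d ^ α ≤ (1 + R) * d ^ β := by
  have h : d ^ α = d ^ (α - β) * d ^ β := by
    rw [← Real.rpow_add_of_nonneg hd (sub_nonneg.2 hβα) hβ, sub_add_cancel]
  rw [h]
  refine mul_le_mul_of_nonneg_right ?_ (Real.rpow_nonneg hd _)
  calc d ^ (α - β) ≤ (1 + R) ^ (α - β) :=
        Real.rpow_le_rpow hd (by linarith) (sub_nonneg.2 hβα)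
    _ ≤ (1 + R) ^ (1 : ℝ) := Real.rpow_le_rpow_of_exponent_le (by linarith) (by linarith)
    _ = 1 + R := Real.rpow_one _

theorem IsHolderOn.continuousOn {S : Set (Cn n)} {u : Cn n → ℝ} (hu : IsHolderOn S u) :
    ContinuousOn u S := by
  obtain ⟨C, α, h0, -, h⟩ := hu
  exact h.continuousOn h0

theorem IsHolderOn.exists_bound {D : Set (Cn n)} (hD : Bornology.IsBounded D) {u : Cn n → ℝ}
    (hu : IsHolderOn (closure D) u) : ∃ M, 0 ≤ M ∧ ∀ x ∈ closure D, |u x| ≤ M := by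
  obtain ⟨M, hM⟩ := hD.isCompact_closure.exists_bound_of_continuousOn hu.continuousOn
  exact ⟨max M 0, le_max_right _ _, fun x hx => (hM x hx).trans (le_max_left _ _)⟩

theorem isHolderOn_const (S : Set (Cn n)) (c : ℝ) : IsHolderOn S fun _ => c :=
  isHolderOn_iff.2 ⟨0, 1, le_rfl, one_pos, le_rfl, by simp⟩

theorem IsHolderOn.add {S : Set (Cn n)} (hS : Bornology.IsBounded S) {u v : Cn n → ℝ}
    (hu : IsHolderOn S u) (hv : IsHolderOn S v) : IsHolderOn S fun x => u x + v x := by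
  obtain ⟨C, α, hC, hα, hα1, h⟩ := isHolderOn_iff.1 hu
  obtain ⟨C', β, hC', hβ, hβ1, h'⟩ := isHolderOn_iff.1 hv
  obtain ⟨R, hR⟩ := Metric.isBounded_iff.1 hS
  refine isHolderOn_iff.2 ⟨(C + C') * (1 + |R|), min α β, by positivity, lt_min hα hβ,
    (min_le_left _ _).trans hα1, fun x hx y hy => ?_⟩
  have hd := (hR hx hy).trans (le_abs_self R)
  have h1 := Real.rpow_le_one_add_mul_rpow dist_nonneg hd (lt_min hα hβ).le (min_le_left α β) hα1
  have h2 := Real.rpow_le_one_add_mul_rpow dist_nonneg hd (lt_min hα hβ).le (min_le_right α β) hβ1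
  calc |u x + v x - (u y + v y)| = |(u x - u y) + (v x - v y)| := by ring_nf
    _ ≤ |u x - u y| + |v x - v y| := abs_add_le _ _
    _ ≤ C * dist x y ^ α + C' * dist x y ^ β := add_le_add (h x hx y hy) (h' x hx y hy)
    _ ≤ C * ((1 + |R|) * dist x y ^ min α β) + C' * ((1 + |R|) * dist x y ^ min α β) :=
        add_le_add (mul_le_mul_of_nonneg_left h1 hC) (mul_le_mul_of_nonneg_left h2 hC')
    _ = _ := by ring

theorem IsHolderOn.sum {ι : Type*} {S : Set (Cn n)} (hS : Bornology.IsBounded S) (s : Finset ι)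
    {u : ι → Cn n → ℝ} (hu : ∀ i ∈ s, IsHolderOn S (u i)) :
    IsHolderOn S fun x => ∑ i ∈ s, u i x := by
  classical
  induction s using Finset.induction_on with
  | empty => simpa using isHolderOn_const S 0
  | insert i s hi ih =>
    simp only [Finset.sum_insert hi]
    exact (hu i (Finset.mem_insert_self i s)).add hS
      (ih fun j hj => hu j (Finset.mem_insert_of_mem hj))

/-- A bounded function which is Hölder continuous at small scales is Hölder continuous. -/
theorem isHolderOn_of_dist_lt {S : Set (Cn n)} {u : Cn n → ℝ} {B C α δ : ℝ} (hC : 0 ≤ C)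
    (hα : 0 < α) (hα1 : α ≤ 1) (hδ : 0 < δ) (hB : 0 ≤ B) (hb : ∀ x ∈ S, |u x| ≤ B)
    (h : ∀ x ∈ S, ∀ y ∈ S, dist x y < δ → |u x - u y| ≤ C * dist x y ^ α) : IsHolderOn S u := by
  -- At distances at least `δ`, the trivial bound `2B` is at most `(2B / δ^α) · dist^α`.
  refine isHolderOn_iff.2 ⟨C + 2 * B / δ ^ α, α, by positivity, hα, hα1, fun x hx y hy => ?_⟩
  have hd : 0 ≤ dist x y ^ α := Real.rpow_nonneg dist_nonneg _
  rw [add_mul]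
  rcases lt_or_ge (dist x y) δ with hlt | hge
  · have : 0 ≤ 2 * B / δ ^ α * dist x y ^ α := by positivity
    linarith [h x hx y hy hlt]
  · have h1 : δ ^ α ≤ dist x y ^ α := Real.rpow_le_rpow hδ.le hge hα.le
    have h2 : 2 * B ≤ 2 * B / δ ^ α * dist x y ^ α := by
      rw [div_mul_eq_mul_div, le_div_iff₀ (Real.rpow_pos_of_pos hδ α)]
      exact mul_le_mul_of_nonneg_left h1 (by positivity)
    have h3 : |u x - u y| ≤ 2 * B := (abs_sub _ _).trans (by linarith [hb x hx, hb y hy])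
    have h4 : 0 ≤ C * dist x y ^ α := by positivity
    linarith

/-- A negative solution near `z` extends, by gluing with a quadratic function, to a Hölder
continuous plurisubharmonic function on the whole domain. -/
theorem IsSolution.exists_extension {Ω : Set (Cn n)} (hopen : IsOpen Ω)
    (hbdd : Bornology.IsBounded Ω) {z : Cn n} {r : ℝ} (hr : 0 < r) {w : Cn n → ℝ}
    {ν : Measure (Cn n)} (hw : IsSolution (Ω ∩ Metric.ball z r) ν w)
    (hneg : ∀ p ∈ Ω ∩ Metric.ball z r, w p < 0) :
    ∃ g : Cn n → ℝ, IsHolderOn (closure Ω) g ∧ IsPSH Ω g ∧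
      EqOn g w (Ω ∩ Metric.ball z (r / 3)) := by
  classical
  set D := Ω ∩ Metric.ball z r with hD
  have hDo : IsOpen D := hopen.inter Metric.isOpen_ball
  obtain ⟨M, hM0, hM⟩ := hw.holder.exists_bound (hbdd.subset inter_subset_left)
  have hcl : closure Ω ∩ Metric.ball z r ⊆ closure D :=
    Metric.isOpen_ball.closure_inter
  -- Needed also on the boundary of `Ω` inside the ball, where the glued function must be Hölder:
  -- there `w` vanishes.
  have hw0 : ∀ x ∈ closure D, w x ≤ 0 := fun x hx => by
    by_cases hxD : x ∈ D
    · exact (hneg x hxD).le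
    · exact (hw.boundary x ⟨hx, by rwa [hDo.interior_eq]⟩).le
  -- `q` vanishes at radius `2r/3`, and for this `A` it equals `-A r² / 3 = -M` at radius `r/3`. So
  -- `q` wins outside the first sphere and `w` inside the second.
  set A := 3 * M / r ^ 2 with hA
  have hA0 : 0 ≤ A := by positivity
  set q : Cn n → ℝ := fun x => A * (‖x - z‖ ^ 2 - (2 * r / 3) ^ 2) with hq
  have hqc : Continuous q := by fun_prop
  set g : Cn n → ℝ := fun x => if x ∈ Metric.ball z r then max (w x) (q x) else q x with hg
  have hgin : ∀ x ∈ Metric.ball z r, g x = max (w x) (q x) := fun x hx => if_pos hx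
  have hgout : ∀ x ∈ closure Ω, 2 * r / 3 < dist x z → g x = q x := fun x hx hxz => by
    by_cases hxr : x ∈ Metric.ball z r
    · rw [hgin x hxr]
      refine max_eq_right ((hw0 x (hcl ⟨hx, hxr⟩)).trans (mul_nonneg hA0 (sub_nonneg.2 ?_)))
      rw [← dist_eq_norm]
      exact pow_le_pow_left₀ (by positivity) hxz.le 2
    · exact if_neg hxr
  have hcΩ := hbdd.isCompact_closure
  have hbcl : Bornology.IsBounded (closure Ω) := hcΩ.isBounded
  have hgH : IsHolderOn (closure Ω) g := by
    obtain ⟨C, α, hC, hα, hα1, h⟩ := isHolderOn_iff.1 hw.holder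
    obtain ⟨R, hR0, hR⟩ := hbcl.subset_closedBall_lt 0 z
    obtain ⟨Q, hQ⟩ := hcΩ.exists_bound_of_continuousOn hqc.continuousOn
    have hqL : ∀ x ∈ closure Ω, ∀ y ∈ closure Ω,
        |q x - q y| ≤ A * (2 * R) * (1 + 2 * R) * dist x y ^ α := fun x hx y hy => by
      have hx' : ‖x - z‖ ≤ R := by simpa [dist_eq_norm] using hR hx
      have hy' : ‖y - z‖ ≤ R := by simpa [dist_eq_norm] using hR hy
      have h1 : |‖x - z‖ - ‖y - z‖| ≤ dist x y := by
        have := abs_norm_sub_norm_le (x - z) (y - z)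
        rwa [sub_sub_sub_cancel_right, ← dist_eq_norm x y] at this
      have h2 : dist x y ≤ 2 * R := by
        have := dist_triangle_right x y z
        rw [dist_eq_norm x z, dist_eq_norm y z] at this
        linarith
      have h3 := Real.rpow_le_one_add_mul_rpow dist_nonneg h2 hα.le hα1 le_rfl
      rw [Real.rpow_one] at h3
      have h4 : q x - q y = A * ((‖x - z‖ + ‖y - z‖) * (‖x - z‖ - ‖y - z‖)) := by
        simp only [hq]
        ring
      rw [h4, abs_mul, abs_mul, abs_of_nonneg hA0, abs_of_nonneg (by positivity), mul_assoc A,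
        mul_assoc A, mul_assoc (2 * R)]
      refine mul_le_mul_of_nonneg_left ?_ hA0
      exact mul_le_mul (by linarith) (h1.trans h3) (abs_nonneg _) (by positivity)
    -- At scale `r/3` either both points lie in the ball, where `g` is a maximum of two Hölder
    -- functions, or one lies outside and both are farther than `2r/3` from `z`, where `g = q`.
    refine isHolderOn_of_dist_lt (B := M + |Q|) (C := C + A * (2 * R) * (1 + 2 * R)) (δ := r / 3)
      (by positivity) hα hα1 (by positivity) (by positivity) (fun x hx => ?_)
      fun x hx y hy hxy => ?_
    · have hqx : |q x| ≤ |Q| := (hQ x hx).trans (le_abs_self Q)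
      by_cases hxr : x ∈ Metric.ball z r
      · rw [hgin x hxr]
        have hwx := hM x (hcl ⟨hx, hxr⟩)
        exact abs_max_le_max_abs_abs.trans
          (max_le (by linarith [abs_nonneg Q]) (by linarith))
      · rw [show g x = q x from if_neg hxr]
        linarith
    · have hd : 0 ≤ dist x y ^ α := Real.rpow_nonneg dist_nonneg _
      have h1 := hqL x hx y hy
      rw [add_mul]
      by_cases hin : x ∈ Metric.ball z r ∧ y ∈ Metric.ball z r
      · rw [hgin x hin.1, hgin y hin.2]
        have h2 := h x (hcl ⟨hx, hin.1⟩) y (hcl ⟨hy, hin.2⟩)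
        exact (abs_max_sub_max_le_max _ _ _ _).trans (max_le_add_of_nonneg (abs_nonneg _)
          (abs_nonneg _)) |>.trans (add_le_add h2 h1)
      · have h3 : 2 * r / 3 < dist x z ∧ 2 * r / 3 < dist y z := by
          rw [not_and_or, Metric.mem_ball, Metric.mem_ball, not_lt, not_lt] at hin
          rcases hin with h4 | h4
          · have := dist_triangle x y z
            exact ⟨by linarith, by linarith⟩
          · have := dist_triangle_left y z x
            exact ⟨by linarith [dist_comm x y, dist_triangle y x z], by linarith⟩
        rw [hgout x hx h3.1, hgout y hy h3.2]
        have : 0 ≤ C * dist x y ^ α := by positivity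
        linarith
  refine ⟨g, hgH, ?_, ?_⟩
  · refine IsPSH.of_local (hgH.continuousOn.mono subset_closure) fun p hp => ?_
    -- Two open sets cover `Ω`: on `D` the function is a maximum, and beyond radius `2r/3` it is
    -- `q`.
    by_cases hpr : p ∈ Metric.ball z r
    · refine ⟨D, hDo, ⟨hp, hpr⟩, ?_⟩
      refine (hw.psh.max (isPSH_quadratic D z hA0 _) (hw.holder.continuousOn.mono subset_closure)
        hqc.continuousOn).congr fun x hx => (hgin x hx.2).symm
    · refine ⟨Ω ∩ {x | 2 * r / 3 < dist x z}, hopen.inter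
        (isOpen_lt continuous_const (continuous_id.dist continuous_const)), ⟨hp, ?_⟩, ?_⟩
      · rw [Metric.mem_ball, not_lt] at hpr
        change 2 * r / 3 < dist p z
        linarith
      · exact (isPSH_quadratic _ z hA0 _).congr fun x hx =>
          (hgout x (subset_closure hx.1) hx.2).symm
  · intro x hx
    have hxr : dist x z < r / 3 := hx.2
    have hxb : x ∈ Metric.ball z r := by
      rw [Metric.mem_ball]
      linarith
    rw [hgin x hxb]
    refine max_eq_left ?_
    have h1 : ‖x - z‖ ^ 2 ≤ (r / 3) ^ 2 := by
      rw [← dist_eq_norm]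
      exact pow_le_pow_left₀ dist_nonneg hxr.le 2
    have h2 : q x ≤ -M := by
      calc q x ≤ A * ((r / 3) ^ 2 - (2 * r / 3) ^ 2) :=
            mul_le_mul_of_nonneg_left (by linarith) hA0
        _ = -M := by
          rw [hA]
          field_simp
          ring
    linarith [neg_abs_le (w x), hM x (subset_closure (⟨hx.1, hxb⟩ : x ∈ D))]

theorem IsHolderOn.exists_isContPSH {Ω : Set (Cn n)} (hbdd : Bornology.IsBounded Ω)
    {u : Cn n → ℝ} (hu : IsHolderOn (closure Ω) u) (hpsh : IsPSH Ω u) :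
    ∃ M, IsContPSH Ω M u := by
  obtain ⟨M, hM0, hM⟩ := hu.exists_bound hbdd
  exact ⟨M, hu.continuousOn.mono subset_closure, hpsh, hM0, fun x hx => hM x (subset_closure hx)⟩

end Gluing

/-! ### The global function as a finite sum of extensions -/

/-- `μ` is a Borel measure on `ℂⁿ` of which only the restriction to `Ω` is used. -/
theorem theorem1 (n : ℕ) (Ω : Set (Cn n)) (hopen : IsOpen Ω) (hconn : IsConnected Ω)
    (hbdd : Bornology.IsBounded Ω) (μ : Measure (Cn n))
    (hloc : ∀ z ∈ closure Ω, ∃ r : ℝ, 0 < r ∧ ∃ w : Cn n → ℝ,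
      IsSubsolution (Ω ∩ Metric.ball z r) μ w ∧ ∀ p ∈ Ω ∩ Metric.ball z r, w p < 0) :
    ∃ u : Cn n → ℝ, IsHolderOn (closure Ω) u ∧ IsPSH Ω u ∧ MongeAmpereGE Ω u μ := by
  classical
  choose! r hr w hsub hneg using hloc
  choose! ν hμν hsol using hsub
  have hext : ∀ z ∈ closure Ω, ∃ g : Cn n → ℝ, IsHolderOn (closure Ω) g ∧ IsPSH Ω g ∧
      EqOn g (w z) (Ω ∩ Metric.ball z (r z / 3)) := fun z hz =>
    (hsol z hz).exists_extension hopen hbdd (hr z hz) (hneg z hz)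
  choose! g hgH hgP hgw using hext
  -- The balls are those of radius `r z / 3`, where the extension still equals the sub-solution.
  -- Compactness needs centres on the boundary of `Ω` too.
  obtain ⟨T, hTΩ, hcov⟩ := hbdd.isCompact_closure.elim_nhds_subcover
    (fun z => Metric.ball z (r z / 3)) fun z hz => Metric.ball_mem_nhds z (by
      have := hr z hz
      positivity)
  have hbcl : Bornology.IsBounded (closure Ω) := hbdd.isCompact_closure.isBounded
  set u : Cn n → ℝ := fun x => ∑ z ∈ T, g z x with hu
  have huH : IsHolderOn (closure Ω) u := IsHolderOn.sum hbcl T fun z hz => hgH z (hTΩ z hz)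
  have huP : IsPSH Ω u := IsPSH.sum T fun z hz => hgP z (hTΩ z hz)
  obtain ⟨M, hM⟩ := huH.exists_isContPSH hbdd huP
  obtain ⟨ν', hν'⟩ := hM.exists_isMongeAmpere hopen
  refine ⟨u, huH, huP, ν', hν', restrict_le_of_forall_mem_nhds fun p hp => ?_⟩
  obtain ⟨z, hzT, hpz⟩ := mem_iUnion₂.1 (hcov (subset_closure hp))
  have hzΩ := hTΩ z hzT
  set W := Ω ∩ Metric.ball z (r z / 3) with hW
  have hWo : IsOpen W := hopen.inter Metric.isOpen_ball
  have hWD : W ⊆ Ω ∩ Metric.ball z (r z) :=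
    inter_subset_inter_right _ (Metric.ball_subset_ball (by linarith [hr z hzΩ]))
  -- The closed ball lies in `W`, so both Monge-Ampère measures are finite on the open one.
  obtain ⟨ρ, hρ, hρW⟩ := Metric.nhds_basis_closedBall.mem_iff.1 (hWo.mem_nhds ⟨hp, hpz⟩)
  have hball : Metric.ball p ρ ⊆ W := Metric.ball_subset_closedBall.trans hρW
  obtain ⟨M₁, hM₁⟩ := (hsol z hzΩ).holder.exists_isContPSH (hbdd.subset inter_subset_left)
    (hsol z hzΩ).psh
  -- The remaining summands form the plurisubharmonic function added to `w z`: on `W`, `u` is `w z`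
  -- plus their sum.
  obtain ⟨M₂, hM₂⟩ := (IsHolderOn.sum hbcl (T.erase z) fun y hy =>
    hgH y (hTΩ y (Finset.mem_of_mem_erase hy))).exists_isContPSH hbdd
    (IsPSH.sum (T.erase z) fun y hy => hgP y (hTΩ y (Finset.mem_of_mem_erase hy)))
  have hνW := (hsol z hzΩ).mongeAmpere.mono hWD
  have hν'W := hν'.mono (inter_subset_left : W ⊆ Ω)
  have hfin : ∀ {v : Cn n → ℝ} {m : Measure (Cn n)}, IsMongeAmpere W v m →
      m (Metric.ball p ρ) < ⊤ := fun h =>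
    (measure_mono Metric.ball_subset_closedBall).trans_lt
      (h.finite_on_compacts _ (isCompact_closedBall p ρ) hρW)
  have h1 : (ν z).restrict (Metric.ball p ρ) ≤ ν'.restrict (Metric.ball p ρ) := by
    refine restrict_ball_le_of_integral_le (hfin hνW) (hfin hν'W) fun f hf hfc hfs hf0 => ?_
    refine IsMongeAmpere.integral_le_of_add hWo (hM₁.mono hWD) (hM₂.mono inter_subset_left)
      (hM.mono inter_subset_left) (fun x hx => ?_) hνW hν'W hf hfc (hfs.trans hball) hf0
    rw [← hgw z hzΩ hx]
    exact (Finset.add_sum_erase T (fun y => g y x) hzT).symm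
  refine ⟨Metric.ball p ρ, Metric.isOpen_ball, Metric.mem_ball_self hρ, le_trans ?_ h1⟩
  have h2 := Measure.restrict_mono_measure (hμν z hzΩ) (Metric.ball p ρ)
  rwa [Measure.restrict_restrict_of_subset (hball.trans hWD),
    Measure.restrict_restrict_of_subset (hball.trans hWD)] at h2
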